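/- Let $\Bbbk$ be a nontrivial commutative ring and $\delta\in\Bbbk$. For $m,n\ge 0$, an $(m,n)$-diagram is a planar (non-crossing) perfect matching of $m$ bottom sites and $n$ top sites of a horizontal strip. In the Temperley--Lieb category $\mathscr{TL}$, with objects $0,1,2,\dots$, the space $\operatorname{Hom}(m,n)$ is the free $\Bbbk$-module on the $(m,n)$-diagrams, composition is vertical concatenation with each closed loop replaced by a factor $\delta$, and $\otimes$ is horizontal concatenation; $\mathsf{TL}_n=\operatorname{End}(n)$. The through degree of a diagram is its number of lines joining bottom to top, and $\mathbf{td}(<l)$ denotes the span of the diagrams of through degree less than $l$ in any morphism space. Let $*$ be the linear map reflecting diagrams in a horizontal line. Let $G=(G_n)_{n\ge0}$ be a family with $G_n\in\operatorname{End}(n)$. For $F\in\operatorname{Hom}(m,n)$ put $\varepsilon_{+1}(F)=G_{n+1}\circ(F\otimes \mathrm{id}_1)\in\operatorname{Hom}(m+1,n+1)$ and, if $n\ge1$, $\varepsilon_{-1}(F)=G_{n-1}\circ(\mathrm{id}_{n-1}\otimes\mathrm{cap})\circ(F\otimes\mathrm{id}_1)\in\operatorname{Hom}(m+1,n-1)$,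 where $\mathrm{cap}$ is the $(2,0)$-diagram. For integers $n,l\ge 0$ let $M_n(l)$ be the set of standard Young tableaux of shape $(\lambda_1,\lambda_2)\vdash n$ with $\lambda_1-\lambda_2=l$ (empty if there is no such shape). For $t\in M_n(l)$ let $s_i=+1$ if $i$ lies in the first row of $t$ and $s_i=-1$ if it lies in the second, let $\delta^G_t=\varepsilon_{s_n}\cdots\varepsilon_{s_1}(\text{empty diagram})\in\operatorname{Hom}(n,l)$ and $\upsilon^G_t=(\delta^G_t)^*\in\operatorname{Hom}(l,n)$. For $s\in M_b(l)$, $t\in M_a(l)$ put $c^G_{s,t}=\upsilon^G_s\circ\delta^G_t\in\operatorname{Hom}(a,b)$. Write $c^{\mathrm{id}}$, $\upsilon^{\mathrm{id}}$ for the case $G_n=\mathrm{id}_n$ for all $n$. On $M_n(l)$ let $s\mathrel{\underline{\blacktriangleleft}}t$ (reverse lexicographic order) mean that $s=t$, or $s(i)\trianglelefteq t(i)$ for the largest $i$ with $s(i)\ne t(i)$, where $t(i)$ is the Young diagram of the boxes of $t$ containing $1,\dots,i$ and $\trianglelefteq$ is the dominance order. Write $s\blacktriangleleft t$ if moreover $s\neq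 t$. Suppose that $G_n\equiv\mathrm{id}_n\pmod{\mathbf{td}(<n)}$ for all $n\ge 0$. Then: 1. For all $a,b\ge 0$, the family $(c^G_{s,t})$, indexed by all $l\geq 0$, $s\in M_b(l)$, $t\in M_a(l)$, is a $\Bbbk$-basis of $\operatorname{Hom}(a,b)$. 2. For all $n$, $\mathsf{TL}_n$ is a cellular algebra with cellular basis $\mathscr B(G)=\{c^G_{s,t}\}$. Precisely, with $\Lambda_n=\{\lambda_1-\lambda_2:(\lambda_1,\lambda_2)\vdash n\}$ ordered as integers: $\mathsf{TL}_n$ is associative and unital; the sets $M_n(l)$ are finite; $(l,s,t)\mapsto c^G_{s,t}$ for $l\in\Lambda_n$, $s,t\in M_n(l)$ is injective with image a basis of $\mathsf{TL}_n$; $*$ is a linear anti-involution with $(c^G_{s,t})^*=c^G_{t,s}$; and for all $l\in\Lambda_n$ and $x\in\mathsf{TL}_n$ there are scalars $r_x(u,s)$ for $u,s\in M_n(l)$ such that for all $s,t\in M_n(l)$, $x\,c^G_{s,t}-\sum_{u\in M_n(l)}r_x(u,s)\,c^G_{u,t}$ lies in the span of the $c^G_{v,w}$ with $v,w\in M_n(l')$,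 $l'<l$. 3. The change of basis from the diagram basis is unitriangular with respect to the reverse lexicographic order. That is: for all $a,b$ the set of all $c^{\mathrm{id}}_{s,t}$ in $\operatorname{Hom}(a,b)$ is the set of all $(a,b)$-diagrams; for all $n,l$ and $t\in M_n(l)$, $$\upsilon^G_t-\upsilon^{\mathrm{id}}_t\in\operatorname{span}\{\upsilon^{\mathrm{id}}_u: u\in M_n(l),\ u\blacktriangleleft t\}+\mathbf{td}(<l);$$ and for all $a,b,l$, $s\in M_b(l)$, $t\in M_a(l)$, $$c^G_{s,t}-c^{\mathrm{id}}_{s,t}\in\operatorname{span}\{c^{\mathrm{id}}_{u,v}: u\mathrel{\underline{\blacktriangleleft}}s,\ v\mathrel{\underline{\blacktriangleleft}}t,\ (u,v)\neq(s,t)\}+\mathbf{td}(<l).$$ -/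

import Mathlib

/-! ### Cellular algebras -/

/-- The algebra `(A, mul, one)` over `R` is an associative unital algebra which is cellular with
cellular data `(Λ, M, c, star)`; the multiplication is an `R`-bilinear map. -/
structure IsCellular (R : Type*) {A Λ : Type*} [CommRing R] [AddCommGroup A] [Module R A]
    [PartialOrder Λ] (mul : A →ₗ[R] A →ₗ[R] A) (one : A)
    (M : Λ → Type*) [∀ w, Fintype (M w)] (c : (w : Λ) → M w → M w → A) (star : A →ₗ[R] A) :
    Prop where
  mul_assoc : ∀ x y z : A, mul (mul x y) z = mul x (mul y z)
  one_mul : ∀ x : A, mul one x = x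
  mul_one : ∀ x : A, mul x one = x
  injective : Function.Injective (fun x : (w : Λ) × (M w × M w) => c x.1 x.2.1 x.2.2)
  linearIndependent :
    LinearIndependent R (fun x : (w : Λ) × (M w × M w) => c x.1 x.2.1 x.2.2)
  span_eq_top :
    Submodule.span R (Set.range fun x : (w : Λ) × (M w × M w) => c x.1 x.2.1 x.2.2) = ⊤
  star_star : ∀ x : A, star (star x) = x
  star_mul : ∀ x y : A, star (mul x y) = mul (star y) (star x)
  star_basis : ∀ (w : Λ) (s t : M w), star (c w s t) = c w t s
  /-- `a c_{s,t} ≡ ∑ᵤ r_a(u, s) c_{u,t}` modulo the span of the lower cells,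
  with `r_a(u, s)` independent of `t`. -/
  mul_basis : ∀ (w : Λ) (a : A), ∃ r : M w → M w → R, ∀ s t : M w,
    mul a (c w s t) - ∑ u : M w, r u s • c w u t ∈
      Submodule.span R {x : A | ∃ v : Λ, v < w ∧ ∃ p q : M v, x = c v p q}

namespace TL

/-! ### Temperley--Lieb diagrams -/

/-- The position of a site of an `(m, n)`-diagram along the boundary of the strip: first the `m`
bottom sites (`Sum.inl`) from left to right, then the `n` top sites (`Sum.inr`) from right to
left. -/
def pos {m n : ℕ} : Fin m ⊕ Fin n → ℕ
  | .inl i => i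
  | .inr j => m + (n - 1 - j)

/-- An `(m, n)`-diagram (up to isotopy): a perfect matching `pair` of the `m` bottom and `n` top
sites such that no two lines cross, i.e. no two pairs interleave along the boundary. -/
@[ext]
structure Diagram (m n : ℕ) where
  pair : Fin m ⊕ Fin n → Fin m ⊕ Fin n
  pair_pair : ∀ x, pair (pair x) = x
  pair_ne : ∀ x, pair x ≠ x
  planar : ∀ x y, ¬ (pos x < pos y ∧ pos y < pos (pair x) ∧ pos (pair x) < pos (pair y))

noncomputable instance (m n : ℕ) : Fintype (Diagram m n) :=
  Fintype.ofInjective Diagram.pair fun _ _ h => Diagram.ext h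

namespace Diagram

/-- The through degree: the number of lines joining a bottom site to a top site. -/
noncomputable def throughDegree {m n : ℕ} (D : Diagram m n) : ℕ :=
  Nat.card {i : Fin m // ∃ j : Fin n, D.pair (.inl i) = .inr j}

/-- The identity diagram, consisting of `n` vertical lines. -/
def idn (n : ℕ) : Diagram n n where
  pair := Sum.swap
  pair_pair := Sum.swap_swap
  pair_ne := by rintro (i | i) <;> simp
  planar := by
    rintro (⟨i, hi⟩ | ⟨i, hi⟩) (⟨j, hj⟩ | ⟨j, hj⟩) <;> simp only [pos, Sum.swap_inl, Sum.swap_inr] <;> omega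

/-- The cap, joining two bottom sites. -/
def cap : Diagram 2 0 where
  pair := Sum.map Fin.rev id
  pair_pair := by rintro (i | i) <;> simp
  pair_ne := by
    rintro (i | i)
    · fin_cases i <;> decide
    · exact i.elim0
  planar := by
    rintro (⟨i, hi⟩ | ⟨i, hi⟩) (⟨j, hj⟩ | ⟨j, hj⟩) <;>
      simp only [pos, Sum.map_inl, Fin.rev] <;> omega

/-- Reflection in a horizontal line. -/
def flip {m n : ℕ} (D : Diagram m n) : Diagram n m where
  pair x := (D.pair x.swap).swap
  pair_pair x := by simp [D.pair_pair]
  pair_ne x h := D.pair_ne x.swap (by simpa using congrArg Sum.swap h)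
  planar x y := by
    have key : ∀ z : Fin m ⊕ Fin n, pos z.swap + pos z + 1 = m + n := by
      rintro (⟨i, hi⟩ | ⟨i, hi⟩) <;> simp only [pos, Sum.swap_inl, Sum.swap_inr] <;> omega
    have h1 := D.planar (D.pair y.swap) (D.pair x.swap)
    rw [D.pair_pair, D.pair_pair] at h1
    have h2 := key (D.pair x.swap)
    have h3 := key (D.pair y.swap)
    have h4 := key x.swap
    have h5 := key y.swap
    rw [Sum.swap_swap] at h4 h5
    have h6 := D.planar x.swap y.swap
    omega

/-- The sites of two diagrams placed side by side. -/
def sites (m m' n n' : ℕ) :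
    (Fin m ⊕ Fin n) ⊕ (Fin m' ⊕ Fin n') ≃ Fin (m + m') ⊕ Fin (n + n') :=
  (Equiv.sumSumSumComm _ _ _ _).trans (Equiv.sumCongr finSumFinEquiv finSumFinEquiv)

/-- Horizontal concatenation, with `D` on the left and `E` on the right. -/
def tensor {m n m' n' : ℕ} (D : Diagram m n) (E : Diagram m' n') :
    Diagram (m + m') (n + n') where
  pair x := sites m m' n n' (Sum.map D.pair E.pair ((sites m m' n n').symm x))
  pair_pair x := by
    rw [Equiv.symm_apply_apply, Sum.map_map]
    have : Sum.map (D.pair ∘ D.pair) (E.pair ∘ E.pair) = id := by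
      ext (z | z) <;> simp [D.pair_pair, E.pair_pair]
    rw [this, id, Equiv.apply_symm_apply]
  pair_ne x h := by
    have h' := (Equiv.eq_symm_apply _).2 h
    rcases hx : (sites m m' n n').symm x with z | z <;> rw [hx] at h'
    · exact D.pair_ne z (Sum.inl_injective h')
    · exact E.pair_ne z (Sum.inr_injective h')
  planar x y := by
    have hl : ∀ z : Fin m ⊕ Fin n,
        (pos z < m ∧ pos (sites m m' n n' (.inl z)) = pos z) ∨
        (m ≤ pos z ∧ pos (sites m m' n n' (.inl z)) = pos z + m' + n') := by
      rintro (⟨i, hi⟩ | ⟨i, hi⟩) <;>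
        simp [sites, pos, Equiv.sumSumSumComm] <;> omega
    have hr : ∀ z : Fin m' ⊕ Fin n',
        pos z < m' + n' ∧ pos (sites m m' n n' (.inr z)) = pos z + m := by
      rintro (⟨i, hi⟩ | ⟨i, hi⟩) <;>
        simp [sites, pos, Equiv.sumSumSumComm] <;> omega
    obtain ⟨x, rfl⟩ := (sites m m' n n').surjective x
    obtain ⟨y, rfl⟩ := (sites m m' n n').surjective y
    rw [Equiv.symm_apply_apply, Equiv.symm_apply_apply]
    rcases x with x | x <;> rcases y with y | y <;> simp only [Sum.map_inl, Sum.map_inr]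
    · have := D.planar x y
      have h1 := hl x
      have h2 := hl y
      have h3 := hl (D.pair x)
      have h4 := hl (D.pair y)
      omega
    · have h1 := hl x
      have h2 := hr y
      have h3 := hl (D.pair x)
      have h4 := hr (E.pair y)
      omega
    · have h1 := hr x
      have h2 := hl y
      have h3 := hr (E.pair x)
      have h4 := hl (D.pair y)
      omega
    · have := E.planar x y
      have h1 := hr x
      have h2 := hr y
      have h3 := hr (E.pair x)
      have h4 := hr (E.pair y)
      omega

/-- The picture obtained by stacking `E` on top of `D`, as a graph on the bottom, middle and top
sites; its edges are the lines of `D` and of `E`. -/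
def stack {m n p : ℕ} (E : Diagram n p) (D : Diagram m n) :
    SimpleGraph (Fin m ⊕ (Fin n ⊕ Fin p)) :=
  SimpleGraph.fromRel fun u v =>
    (∃ x : Fin m ⊕ Fin n, u = Sum.map id Sum.inl x ∧ v = Sum.map id Sum.inl (D.pair x)) ∨
    (∃ y : Fin n ⊕ Fin p, u = Sum.inr y ∧ v = Sum.inr (E.pair y))

/-- The number of closed loops when stacking `E` on top of `D`: the number of connected components
of the picture which only meet middle sites. -/
noncomputable def loops {m n p : ℕ} (E : Diagram n p) (D : Diagram m n) : ℕ :=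
  Nat.card {C : (stack E D).ConnectedComponent // ∀ v ∈ C.supp, ∃ j : Fin n, v = .inr (.inl j)}

/-- `F` is the diagram obtained by stacking `E` on top of `D` and erasing the closed loops: it
joins two distinct outer sites exactly when they are connected in the picture. -/
def IsConcat {m n p : ℕ} (E : Diagram n p) (D : Diagram m n) (F : Diagram m p) : Prop :=
  ∀ x y : Fin m ⊕ Fin p, F.pair x = y ↔
    x ≠ y ∧ (stack E D).Reachable (Sum.map id Sum.inr x) (Sum.map id Sum.inr y)

end Diagram

/-! ### The Temperley--Lieb category -/

/-- The space of morphisms `m ⟶ n`: the free `k`-module on the `(m, n)`-diagrams. -/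
abbrev Hom (k : Type*) [CommRing k] (m n : ℕ) : Type _ := Diagram m n →₀ k

section Category

variable {k : Type*} [CommRing k]

/-- A diagram as a morphism. -/
noncomputable def ofDiagram {m n : ℕ} (D : Diagram m n) : Hom k m n := Finsupp.single D 1

/-- The identity morphism `id_n`. -/
noncomputable def idHom (k : Type*) [CommRing k] (n : ℕ) : Hom k n n := ofDiagram (Diagram.idn n)

open Classical in
/-- The composite `E ∘ D` of two diagrams: the vertical concatenation with every closed loop
replaced by a factor `δ`. (Exactly one `F` is the
concatenation of `D` and `E`.) -/
noncomputable def compDiagram (δ : k) {m n p : ℕ} (E : Diagram n p) (D : Diagram m n) :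
    Hom k m p :=
  ∑ F : Diagram m p, if Diagram.IsConcat E D F then δ ^ Diagram.loops E D • ofDiagram F else 0

/-- Composition of morphisms `comp δ f g = f ∘ g`, the bilinear extension of the composition of
diagrams. -/
noncomputable def comp (δ : k) {m n p : ℕ} : Hom k n p →ₗ[k] Hom k m n →ₗ[k] Hom k m p :=
  Finsupp.linearCombination k fun E => Finsupp.linearCombination k fun D => compDiagram δ E D

/-- Tensor product of morphisms, the bilinear extension of horizontal concatenation. -/
noncomputable def tensorHom {m n m' n' : ℕ} :
    Hom k m n →ₗ[k] Hom k m' n' →ₗ[k] Hom k (m + m') (n + n') :=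
  Finsupp.linearCombination k fun D =>
    Finsupp.linearCombination k fun E => ofDiagram (D.tensor E)

/-- Reflection of morphisms in a horizontal line, extended linearly. -/
noncomputable def flipHom {m n : ℕ} : Hom k m n →ₗ[k] Hom k n m :=
  Finsupp.linearCombination k fun D => ofDiagram D.flip

/-- `td(< l)`: the morphisms all of whose diagrams have through degree less than `l`. -/
def tdLT (k : Type*) [CommRing k] {m n : ℕ} (l : ℕ) : Submodule k (Hom k m n) :=
  Finsupp.supported k k {D : Diagram m n | D.throughDegree < l}

/-! ### Light ladders -/

/-- `ε₊₁(F) = G_{n+1} ∘ (F ⊗ id₁)`. -/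
noncomputable def epsPlus (δ : k) (G : (n : ℕ) → Hom k n n) {m n : ℕ} (F : Hom k m n) :
    Hom k (m + 1) (n + 1) :=
  comp δ (G (n + 1)) (tensorHom F (idHom k 1))

/-- `ε₋₁(F) = G_n ∘ (id_n ⊗ cap) ∘ (F ⊗ id₁)`, for `F : m ⟶ n + 1`. -/
noncomputable def epsMinus (δ : k) (G : (n : ℕ) → Hom k n n) {m n : ℕ} (F : Hom k m (n + 1)) :
    Hom k (m + 1) n :=
  comp δ (G n) (comp δ (tensorHom (idHom k n) (ofDiagram Diagram.cap) : Hom k (n + 1 + 1) n)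
    (tensorHom F (idHom k 1)))

/-- The down morphism `ε_{s_n} ∘ ⋯ ∘ ε_{s_1} (empty diagram) : n ⟶ l` of a sequence `s` of signs
with nonnegative partial sums and total sum `l`. (The height before the last step is determined by
`l` and the last sign. If `s` does not have these properties, there is no such morphism and the
value is `0`; this never happens for the sequence of a standard tableau.) -/
noncomputable def downSeq (δ : k) (G : (n : ℕ) → Hom k n n) :
    {n : ℕ} → (Fin n → ℤˣ) → (l : ℕ) → Hom k n l
  | 0, _, 0 => idHom k 0
  | 0, _, _ + 1 => 0
  | n + 1, s, l =>
    if s (Fin.last n) = 1 then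
      match l with
      | 0 => 0
      | l' + 1 => epsPlus δ G (downSeq δ G (fun i : Fin n => s i.castSucc) l')
    else epsMinus δ G (downSeq δ G (fun i : Fin n => s i.castSucc) (l + 1))

end Category

/-! ### Standard tableaux -/

/-- Standard Young tableaux of shape `μ ⊢ n`: the box `c` contains the number `entry c + 1`. (There
are none if `μ` does not have `n` boxes.) -/
@[ext]
structure StdTableau (μ : YoungDiagram) (n : ℕ) where
  entry : μ.cells ≃ Fin n
  row_strict : ∀ c d : μ.cells, c.1.1 = d.1.1 → c.1.2 < d.1.2 → entry c < entry d
  col_strict : ∀ c d : μ.cells, c.1.2 = d.1.2 → c.1.1 < d.1.1 → entry c < entry d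

noncomputable instance (μ : YoungDiagram) (n : ℕ) : Fintype (StdTableau μ n) :=
  Fintype.ofInjective StdTableau.entry fun _ _ h => StdTableau.ext h

/-- The dominance order on Young diagrams of the same size. -/
def Dominates (ν μ : YoungDiagram) : Prop :=
  ∀ r : ℕ, ∑ i ∈ Finset.range r, μ.rowLen i ≤ ∑ i ∈ Finset.range r, ν.rowLen i

namespace StdTableau

variable {μ : YoungDiagram} {n : ℕ}

theorem entry_mono (t : StdTableau μ n) (c d : μ.cells) (h₁ : c.1.1 ≤ d.1.1)
    (h₂ : c.1.2 ≤ d.1.2) : t.entry c ≤ t.entry d := by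
  have he : (c.1.1, d.1.2) ∈ μ := μ.up_left_mem h₁ le_rfl d.2
  have a1 : t.entry c ≤ t.entry ⟨_, he⟩ := by
    rcases h₂.lt_or_eq with h | h
    · exact (t.row_strict c ⟨_, he⟩ rfl h).le
    · exact le_of_eq (congrArg _ (Subtype.ext (Prod.ext rfl h)))
  have a2 : t.entry ⟨_, he⟩ ≤ t.entry d := by
    rcases h₁.lt_or_eq with h | h
    · exact (t.col_strict ⟨_, he⟩ d rfl h).le
    · exact le_of_eq (congrArg _ (Subtype.ext (Prod.ext h rfl)))
  exact a1.trans a2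

/-- `t(i)`: the Young diagram of the boxes of `t` containing the numbers `1, …, i`. -/
def sub (t : StdTableau μ n) (i : ℕ) : YoungDiagram where
  cells := μ.cells.filter fun c => ∃ h : c ∈ μ.cells, (t.entry ⟨c, h⟩ : ℕ) + 1 ≤ i
  isLowerSet := by
    intro c d hdc hc
    simp only [Finset.coe_filter, Set.mem_ofPred_eq] at hc ⊢
    obtain ⟨hc, hc', hi⟩ := hc
    have hd : d ∈ μ.cells := μ.isLowerSet hdc hc
    have : t.entry ⟨d, hd⟩ ≤ t.entry ⟨c, hc⟩ := t.entry_mono ⟨d, hd⟩ ⟨c, hc⟩ hdc.1 hdc.2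
    have : (t.entry ⟨d, hd⟩ : ℕ) ≤ t.entry ⟨c, hc⟩ := this
    exact ⟨hd, hd, by omega⟩

/-- The reverse lexicographic order: `s = t`, or `t(i)` dominates `s(i)` for the largest `i` with
`s(i) ≠ t(i)`. -/
def RevLexLE (s t : StdTableau μ n) : Prop :=
  s = t ∨ ∃ i : ℕ, s.sub i ≠ t.sub i ∧ (∀ j : ℕ, i < j → s.sub j = t.sub j) ∧
    Dominates (t.sub i) (s.sub i)

/-- The strict reverse lexicographic order. -/
def RevLexLT (s t : StdTableau μ n) : Prop := s.RevLexLE t ∧ s ≠ t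

/-- The sign sequence of a tableau with at most two rows: `+1` for the numbers in the first row,
`-1` for the numbers in the second row. -/
def signs (t : StdTableau μ n) (i : Fin n) : ℤˣ := if (t.entry.symm i).1.1 = 0 then 1 else -1

end StdTableau

/-- The two-row Young diagram `(l₁, l₂)`. -/
def twoRow (l₁ l₂ : ℕ) (h : l₂ ≤ l₁) : YoungDiagram :=
  YoungDiagram.ofRowLens [l₁, l₂] (by simpa [List.sortedGE_iff_pairwise] using h)

/-- The index set `M_n(l)`: standard tableaux of the shape `(l₁, l₂) ⊢ n` with `l₁ - l₂ = l`. It is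
empty if `l > n` or if `l` and `n` have different parity, as the shape below does not then have
`n` boxes. -/
abbrev Tab (n l : ℕ) : Type :=
  StdTableau (twoRow (l + (n - l) / 2) ((n - l) / 2) (Nat.le_add_left _ _)) n

/-- The poset `Λ_n = {l₁ - l₂ : (l₁, l₂) ⊢ n}`, ordered as integers. -/
abbrev Weight (n : ℕ) : Type := {l : ℕ // ∃ l₁ l₂ : ℕ, l₂ ≤ l₁ ∧ l₁ + l₂ = n ∧ l = l₁ - l₂}

section Ladders

variable {k : Type*} [CommRing k]

/-- The down morphism of a tableau. -/
noncomputable def down (δ : k) (G : (n : ℕ) → Hom k n n) {n l : ℕ} (t : Tab n l) : Hom k n l :=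
  downSeq δ G t.signs l

/-- The up morphism of a tableau: the reflection of the down morphism. -/
noncomputable def up (δ : k) (G : (n : ℕ) → Hom k n n) {n l : ℕ} (t : Tab n l) : Hom k l n :=
  flipHom (down δ G t)

/-- The light ladder morphism `c_{s,t} = up s ∘ down t`. -/
noncomputable def ladder (δ : k) (G : (n : ℕ) → Hom k n n) {a b l : ℕ} (s : Tab b l)
    (t : Tab a l) : Hom k a b :=
  comp δ (up δ G s) (down δ G t)

end Ladders

end TL

/-!
Diagrams are studied through the two-colourings of their sites that are constant on lines. A diagram
`D` thus gives a zero-one matrix `mat D` indexed by colourings of the bottom and of the top sites.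
The matrix determines the diagram, even up to powers of two (`mat_eq_iff`), and a stack of two
diagrams satisfies `mat D * mat E = 2 ^ loops • mat F` (`mat_mul`), as each closed loop may be
coloured in two ways. Associativity, units and the reflection therefore come down to identities
between matrices. Planarity enters only in the existence of `F`: the middle sites are
contracted in pairs, starting from the boundary of the strip (`exists_contract_middle`).

A diagram `n ⟶ l` is full if all its top sites lie on through lines. Bending the last top site down
(`bendDown`) is `(id ⊗ cap) ∘ (- ⊗ id)`, and adding a line is `- ⊗ id`; undoing these two operations
one site at a time shows that full diagrams are the `δ^id_t`, indexed by ballot sequences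
(`Full.isBallot_and_downSeq`), and that every diagram factors uniquely through full half
diagrams (`exists_factorization`, `sgn_of_isConcat`). So the `c^id_{s,t}` are exactly the diagrams.

For general `G`, unitriangularity (`downSeq_sub_mem`) is proved by induction on the number of
sites. The only delicate point is that bending can turn a diagram of lower through degree into a
full one. It then straightens a cup, so that a last sign `-1` is replaced by `+1`, which
makes the sequence smaller in the reverse lexicographic order (`sgn_bendDown_last_of_not_full`).
Unitriangularity shows that the `c^G_{s,t}` span, compatibly with the through degree
(`tdLT_le_span_ladder`). There are as many of them as diagrams, so they form a basis, as surjective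
endomorphisms of finite modules over commutative rings are injective. The cellular
multiplication rule holds because `Hom(l, n)` is spanned by the `υ^G_u` modulo `td(< l)`, and
because `td(< l)` is an ideal.
-/

namespace TL

/-! ### Planar pairings and contraction of neighbouring points -/

/-- Planarity of a pairing `f` of points with positions `q` on a line. -/
def NonCrossing {V : Type*} (q : V → ℕ) (f : V → V) : Prop :=
  ∀ x y, ¬ (q x < q y ∧ q y < q (f x) ∧ q (f x) < q (f y))

/-- A planar pairing restricts to a diagram on any set of sites, embedded in boundary order, that it
preserves without fixed points. -/
theorem exists_diagram_of_nonCrossing {V : Type*} {q : V → ℕ} {f : V → V}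
    (hf : Function.Involutive f) (hp : NonCrossing q f) {m n : ℕ} (ι : Fin m ⊕ Fin n → V)
    (hι : Function.Injective ι) (hmono : ∀ x y, pos x < pos y → q (ι x) < q (ι y))
    (hcl : ∀ x, ∃ y, f (ι x) = ι y) (hne : ∀ x, f (ι x) ≠ ι x) :
    ∃ F : Diagram m n, ∀ x, ι (F.pair x) = f (ι x) := by
  choose g hg using hcl
  refine ⟨⟨g, fun x => hι ?_, fun x h => hne x ?_, fun x y h => hp (ι x) (ι y) ?_⟩,
    fun x => (hg x).symm⟩
  · rw [← hg, ← hg, hf]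
  · rw [hg, h]
  · rw [hg, hg]
    exact ⟨hmono _ _ h.1, hmono _ _ h.2.1, hmono _ _ h.2.2⟩

/-- Removal of the points `a` and `b` from a pairing `f`, joining their partners. Removed points are
encoded as fixed points. -/
def contract {V : Type*} [DecidableEq V] (f : V → V) (a b x : V) : V :=
  if x = a ∨ x = b then x else if x = f a then f b else if x = f b then f a else f x

section Contract

variable {V : Type*} [DecidableEq V] {f : V → V} {a b : V}

theorem contract_involutive (hf : Function.Involutive f) (ha : f a ≠ a) (hb : f b ≠ b) :
    Function.Involutive (contract f a b) := by
  intro x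
  have h1 : ∀ y, f (f y) = y := hf
  have := h1 x
  have := h1 a
  have := h1 b
  unfold contract
  grind

theorem contract_eq_self (hf : Function.Involutive f) (hab : a ≠ b) (x : V) :
    contract f a b x = x ↔ x = a ∨ x = b ∨ f x = x := by
  have h1 : ∀ y, f (f y) = y := hf
  have := h1 x
  have := h1 a
  have := h1 b
  unfold contract
  grind

theorem contract_nonCrossing {q : V → ℕ} (hq : Function.Injective q)
    (hf : Function.Involutive f) (hp : NonCrossing q f) (hab : q a < q b)
    (hfix : ∀ v, q a < q v → q v < q b → f v = v) :
    NonCrossing q (contract f a b) := by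
  -- a chord of `f` has the partners of `a` and of `b` on the same side
  have side : ∀ x, x ≠ a → x ≠ b → x ≠ f a → x ≠ f b → q x < q (f x) →
      ((q x < q (f a) ∧ q (f a) < q (f x)) ↔ (q x < q (f b) ∧ q (f b) < q (f x))) := by
    intro x h1 h2 h3 h4 hx
    have e : ∀ y, f (f y) = y := hf
    have n1 : q x ≠ q a := fun h => h1 (hq h)
    have n2 : q x ≠ q b := fun h => h2 (hq h)
    have n3 : q x ≠ q (f a) := fun h => h3 (hq h)
    have n4 : q x ≠ q (f b) := fun h => h4 (hq h)
    have m1 : q (f x) ≠ q a := fun h => h3 (by rw [← hq h, e])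
    have m2 : q (f x) ≠ q b := fun h => h4 (by rw [← hq h, e])
    have m3 : q (f x) ≠ q (f a) := fun h => h1 (hf.injective (hq h))
    have m4 : q (f x) ≠ q (f b) := fun h => h2 (hf.injective (hq h))
    have i1 : ¬ (q a < q x ∧ q x < q b) := fun h => by
      have := hfix x h.1 h.2; rw [this] at hx; omega
    have i2 : ¬ (q a < q (f x) ∧ q (f x) < q b) := fun h => by
      have := hfix (f x) h.1 h.2; rw [e] at this; rw [← this] at hx; omega
    have key : ∀ c, q x ≠ q c → q x ≠ q (f c) → q (f x) ≠ q c → q (f x) ≠ q (f c) →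
        ((q x < q c ∧ q c < q (f x)) ↔ (q x < q (f c) ∧ q (f c) < q (f x))) := by
      intro c k1 k2 k3 k4
      have p1 := hp x c
      have p2 := hp x (f c)
      have p3 := hp c x
      have p4 := hp (f c) x
      rw [e] at p2 p4
      omega
    rw [← key a n1 n3 m1 m3, ← key b n2 n4 m2 m4]
    omega
  have e : ∀ y, f (f y) = y := hf
  intro x y
  by_cases hx : x = a ∨ x = b
  · have : contract f a b x = x := by unfold contract; rw [if_pos hx]
    rw [this]; omega
  by_cases hy : y = a ∨ y = b
  · have : contract f a b y = y := by unfold contract; rw [if_pos hy]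
    rw [this]; omega
  push Not at hx hy
  have red : ∀ z, z ≠ a → z ≠ b → (z = f a ∧ contract f a b z = f b) ∨
      (z = f b ∧ contract f a b z = f a) ∨
      (z ≠ f a ∧ z ≠ f b ∧ contract f a b z = f z) := by
    intro z h1 h2
    unfold contract
    grind
  have hab' : a ≠ b := fun h => by rw [h] at hab; omega
  have e1 : q a ≠ q b := hab.ne
  rcases red x hx.1 hx.2 with ⟨rx, sx⟩ | ⟨rx, sx⟩ | ⟨rx, rx', sx⟩ <;>
  rcases red y hy.1 hy.2 with ⟨ry, sy⟩ | ⟨ry, sy⟩ | ⟨ry, ry', sy⟩ <;> rw [sx, sy]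
  · rw [rx, ry]; omega
  · rw [rx, ry]; omega
  · rw [rx]
    intro h
    have := side y hy.1 hy.2 ry ry' (by omega)
    omega
  · rw [rx, ry]; omega
  · rw [rx, ry]; omega
  · rw [rx]
    intro h
    have := side y hy.1 hy.2 ry ry' (by omega)
    omega
  · rw [ry]
    intro h
    have := side x hx.1 hx.2 rx rx' (by omega)
    omega
  · rw [ry]
    intro h
    have := side x hx.1 hx.2 rx rx' (by omega)
    omega
  · exact hp x y

theorem contract_colouring (hf : Function.Involutive f)
    (ha : f a ≠ a) (hb : f b ≠ b) (c : V → Bool) :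
    (∀ v, c (contract f a b v) = c v) ↔
      ∃ c' : V → Bool, (∀ v, v ≠ a → v ≠ b → c' v = c v) ∧ (∀ v, c' (f v) = c' v) ∧
        c' a = c' b := by
  have e : ∀ y, f (f y) = y := hf
  have ea := e a
  have eb := e b
  constructor
  · intro h
    have hA := h (f a)
    -- if `a` and `b` are partners, their common colour is arbitrary
    refine ⟨fun v => if v = a ∨ v = b then (if f a = b then true else c (f a)) else c v, ?_, ?_, ?_⟩
    · intro v h1 h2; simp [h1, h2]
    · intro v
      have hv := h v
      have ev := e v
      unfold contract at hA hv
      grind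
    · simp
  · rintro ⟨c', h1, h2, h3⟩ v
    have ha2 := h2 a
    have hb2 := h2 b
    have hv := h2 v
    have ev := e v
    have i1 := h1 v
    have i2 := h1 (f v)
    have i3 := h1 (f a)
    have i4 := h1 (f b)
    have j1 : f v = a → v = f a := fun h => by rw [← h, e]
    have j2 : f v = b → v = f b := fun h => by rw [← h, e]
    unfold contract
    grind

end Contract


/-- The relation between colourings of the bottom and of the top sites given by a diagram: the two
ends of every line have the same colour. -/
def Compat {m n : ℕ} (D : Diagram m n) (x : Fin m → Bool) (y : Fin n → Bool) : Prop :=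
  ∀ z, Sum.elim x y (D.pair z) = Sum.elim x y z

/-! ### Existence of the concatenation of two diagrams -/

section Existence

variable {m n p : ℕ}

/-- The position of the sites of two diagrams on a common line; the top sites of the first diagram
mirror the bottom sites of the second. -/
def joinPos : (Fin m ⊕ Fin n) ⊕ (Fin n ⊕ Fin p) → ℕ
  | .inl z => pos z
  | .inr z => m + n + pos z

theorem pos_injective {m n : ℕ} : Function.Injective (pos : Fin m ⊕ Fin n → ℕ) := by
  rintro (⟨i, hi⟩ | ⟨i, hi⟩) (⟨j, hj⟩ | ⟨j, hj⟩) h <;> simp only [pos] at h <;>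
    simp <;> omega

theorem pos_lt {m n : ℕ} (z : Fin m ⊕ Fin n) : pos z < m + n := by
  rcases z with ⟨i, hi⟩ | ⟨i, hi⟩ <;> simp only [pos] <;> omega

theorem joinPos_injective :
    Function.Injective (joinPos : (Fin m ⊕ Fin n) ⊕ (Fin n ⊕ Fin p) → ℕ) := by
  rintro (z | z) (w | w) h <;> simp only [joinPos] at h
  · rw [pos_injective h]
  · have := pos_lt z; omega
  · have := pos_lt w; omega
  · rw [pos_injective (Nat.add_left_cancel h)]

/-- The middle sites can be contracted one after the other, starting with the leftmost ones. -/
theorem exists_contract_middle (E : Diagram n p) (D : Diagram m n) (j : ℕ) (hj : j ≤ n) :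
    ∃ f : (Fin m ⊕ Fin n) ⊕ (Fin n ⊕ Fin p) → (Fin m ⊕ Fin n) ⊕ (Fin n ⊕ Fin p),
      Function.Involutive f ∧ NonCrossing joinPos f ∧
      (∀ v, f v = v ↔ ∃ i : Fin n, (i : ℕ) < j ∧ (v = .inl (.inr i) ∨ v = .inr (.inl i))) ∧
      ∀ c : (Fin m ⊕ Fin n) ⊕ (Fin n ⊕ Fin p) → Bool, (∀ v, c (f v) = c v) ↔
        ∃ c' : (Fin m ⊕ Fin n) ⊕ (Fin n ⊕ Fin p) → Bool,
          (∀ v, (¬ ∃ i : Fin n, (i : ℕ) < j ∧ (v = .inl (.inr i) ∨ v = .inr (.inl i))) →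
            c' v = c v) ∧
          (∀ v, c' (Sum.map D.pair E.pair v) = c' v) ∧
          ∀ i : Fin n, (i : ℕ) < j → c' (.inl (.inr i)) = c' (.inr (.inl i)) := by
  induction j with
  | zero =>
    refine ⟨Sum.map D.pair E.pair, ?_, ?_, ?_, ?_⟩
    · rintro (v | v) <;> simp [D.pair_pair, E.pair_pair]
    · rintro (v | v) (w | w) <;> simp only [joinPos, Sum.map_inl, Sum.map_inr]
      · exact D.planar v w
      · have := pos_lt (D.pair v); omega
      · have := pos_lt w; omega
      · have := E.planar v w; omega
    · rintro (v | v) <;> simp [D.pair_ne, E.pair_ne]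
    · intro c
      constructor
      · exact fun h => ⟨c, fun _ _ => rfl, h, fun i hi => by omega⟩
      · rintro ⟨c', h1, h2, -⟩
        have : c' = c := funext fun v => h1 v (by simp)
        exact this ▸ h2
  | succ j ih =>
    obtain ⟨f, hf, hp, hfix, hc⟩ := ih (by omega)
    let i₀ : Fin n := ⟨j, hj⟩
    let a : (Fin m ⊕ Fin n) ⊕ (Fin n ⊕ Fin p) := .inl (.inr i₀)
    let b : (Fin m ⊕ Fin n) ⊕ (Fin n ⊕ Fin p) := .inr (.inl i₀)
    have ha : f a ≠ a := by
      rw [Ne, hfix]; rintro ⟨i, hi, h | h⟩ <;> simp [a, i₀] at h; subst h; simp at hi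
    have hb : f b ≠ b := by
      rw [Ne, hfix]; rintro ⟨i, hi, h | h⟩ <;> simp [b, i₀] at h; subst h; simp at hi
    have hab : joinPos a < joinPos b := by simp only [a, b, i₀, joinPos, pos]; omega
    have hne : a ≠ b := fun h => by rw [h] at hab; omega
    -- the removed points, after one more step
    have hrem : ∀ v, (∃ i : Fin n, (i : ℕ) < j + 1 ∧ (v = .inl (.inr i) ∨ v = .inr (.inl i))) ↔
        v = a ∨ v = b ∨
          ∃ i : Fin n, (i : ℕ) < j ∧ (v = .inl (.inr i) ∨ v = .inr (.inl i)) := by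
      intro v
      constructor
      · rintro ⟨i, hi, h⟩
        rcases Nat.lt_succ_iff_lt_or_eq.1 hi with h' | h'
        · exact .inr (.inr ⟨i, h', h⟩)
        · have : i = i₀ := Fin.ext h'
          subst this
          exact h.elim .inl fun h => .inr (.inl h)
      · rintro (h | h | ⟨i, hi, h⟩)
        · exact ⟨i₀, Nat.lt_succ_self j, .inl h⟩
        · exact ⟨i₀, Nat.lt_succ_self j, .inr h⟩
        · exact ⟨i, by omega, h⟩
    refine ⟨contract f a b, contract_involutive hf ha hb,
      contract_nonCrossing joinPos_injective hf hp hab ?_, ?_, ?_⟩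
    · intro v h1 h2
      rw [hfix]
      rcases v with (⟨i, hi⟩ | ⟨i, hi⟩) | (⟨i, hi⟩ | ⟨i, hi⟩) <;>
        simp only [a, b, i₀, joinPos, pos] at h1 h2
      · omega
      · exact ⟨⟨i, hi⟩, by simp only; omega, .inl rfl⟩
      · exact ⟨⟨i, hi⟩, by simp only; omega, .inr rfl⟩
      · omega
    · intro v
      rw [contract_eq_self hf hne, hrem, hfix]
    · intro c
      rw [contract_colouring hf ha hb]
      constructor
      · rintro ⟨c', h1, h2, h3⟩
        obtain ⟨c'', k1, k2, k3⟩ := (hc c').1 h2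
        have na : c'' a = c' a := k1 a ((hfix a).not.1 ha)
        have nb : c'' b = c' b := k1 b ((hfix b).not.1 hb)
        refine ⟨c'', fun v hv => ?_, k2, fun i hi => ?_⟩
        · rw [hrem] at hv
          push Not at hv
          rw [k1 v (by push Not; exact hv.2.2), h1 v hv.1 hv.2.1]
        · rcases Nat.lt_succ_iff_lt_or_eq.1 hi with h' | h'
          · exact k3 i h'
          · have : i = i₀ := Fin.ext h'
            subst this
            exact na.trans (h3.trans nb.symm)
      · rintro ⟨c'', k1, k2, k3⟩
        -- overwrite the colours of the points that were removed before
        refine ⟨fun v => if v = a ∨ v = b then c'' v else c v, ?_, ?_, ?_⟩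
        · intro v h1 h2; simp [h1, h2]
        · refine (hc fun v => if v = a ∨ v = b then c'' v else c v).2 ⟨c'', fun v hv => ?_, k2,
            fun i hi => k3 i (by omega)⟩
          by_cases h : v = a ∨ v = b
          · simp [h]
          · rw [if_neg h]
            refine k1 v ?_
            rw [hrem]
            rintro (h' | h' | h')
            exacts [h (.inl h'), h (.inr h'), hv h']
        · simp only [true_or, or_true, if_true]
          exact k3 i₀ (Nat.lt_succ_self j)

/-- Stacking two diagrams gives a diagram: the relations between colourings given by planar
matchings are closed under composition. -/
theorem exists_compat_comp (E : Diagram n p) (D : Diagram m n) :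
    ∃ F : Diagram m p, ∀ x y, Compat F x y ↔ ∃ z, Compat D x z ∧ Compat E z y := by
  obtain ⟨f, hf, hp, hfix, hc⟩ := exists_contract_middle E D n le_rfl
  let ι : Fin m ⊕ Fin p → (Fin m ⊕ Fin n) ⊕ (Fin n ⊕ Fin p) := Sum.map Sum.inl Sum.inr
  have hι : ∀ z, ¬ ∃ i : Fin n, (i : ℕ) < n ∧ (ι z = .inl (.inr i) ∨ ι z = .inr (.inl i)) := by
    rintro (z | z) ⟨i, -, h | h⟩ <;> simp [ι] at h
  have hcl : ∀ v, (¬ ∃ i : Fin n, (i : ℕ) < n ∧ (v = .inl (.inr i) ∨ v = .inr (.inl i))) →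
      ∃ z, v = ι z := by
    rintro ((i | i) | (i | i)) h
    · exact ⟨.inl i, rfl⟩
    · exact absurd ⟨i, i.2, .inl rfl⟩ h
    · exact absurd ⟨i, i.2, .inr rfl⟩ h
    · exact ⟨.inr i, rfl⟩
  have hne : ∀ z, f (ι z) ≠ ι z := fun z h => hι z ((hfix _).1 h)
  obtain ⟨F, hF⟩ := exists_diagram_of_nonCrossing hf hp ι
    (Sum.map_injective.2 ⟨Sum.inl_injective, Sum.inr_injective⟩)
    (by
      rintro (⟨i, hi⟩ | ⟨i, hi⟩) (⟨j, hj⟩ | ⟨j, hj⟩) <;>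
        simp only [ι, Sum.map_inl, Sum.map_inr, pos, joinPos] <;> omega)
    (fun z => hcl _ fun h => hne (z) (hf.injective ((hfix _).2 h))) hne
  refine ⟨F, fun x y => ?_⟩
  -- a colouring of the outer sites, extended arbitrarily to the middle sites
  let c : (Fin m ⊕ Fin n) ⊕ (Fin n ⊕ Fin p) → Bool :=
    Sum.elim (Sum.elim x fun _ => true) (Sum.elim (fun _ => true) y)
  have hcι : ∀ z, c (ι z) = Sum.elim x y z := by rintro (z | z) <;> rfl
  have h1 : Compat F x y ↔ ∀ v, c (f v) = c v := by
    constructor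
    · intro h v
      by_cases hv : f v = v
      · rw [hv]
      · obtain ⟨z, rfl⟩ := hcl v fun h => hv ((hfix _).2 h)
        rw [← hF, hcι, hcι, h z]
    · intro h z
      rw [← hcι, ← hcι, hF, h]
  rw [h1, hc]
  constructor
  · rintro ⟨c', k1, k2, k3⟩
    have l1 : ∀ z, c' (ι z) = Sum.elim x y z := fun z => by rw [k1 _ (hι z), hcι]
    have e1 : c' ∘ Sum.inl = Sum.elim x fun i => c' (.inl (.inr i)) := by
      ext (z | z)
      · exact l1 (.inl z)
      · rfl
    have e2 : c' ∘ Sum.inr = Sum.elim (fun i => c' (.inl (.inr i))) y := by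
      ext (z | z)
      · exact (k3 z z.2).symm
      · exact l1 (.inr z)
    refine ⟨fun i => c' (.inl (.inr i)), fun z => ?_, fun z => ?_⟩
    · rw [← e1]; exact k2 (.inl z)
    · rw [← e2]; exact k2 (.inr z)
  · rintro ⟨z, k1, k2⟩
    refine ⟨Sum.elim (Sum.elim x z) (Sum.elim z y), ?_, ?_, fun i _ => rfl⟩
    · intro v hv
      obtain ⟨w, rfl⟩ := hcl v hv
      rcases w with w | w <;> rfl
    · rintro (v | v)
      · exact k1 v
      · exact k2 v

end Existence

/-! ### Two-colourings of the stacked picture -/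

section Stack

variable {m n p : ℕ} {E : Diagram n p} {D : Diagram m n} {F : Diagram m p}

theorem reachable_lower (E : Diagram n p) (D : Diagram m n) (z : Fin m ⊕ Fin n) :
    (Diagram.stack E D).Reachable (Sum.map id Sum.inl z) (Sum.map id Sum.inl (D.pair z)) := by
  refine SimpleGraph.Adj.reachable ((SimpleGraph.fromRel_adj _ _ _).2 ⟨fun h => ?_,
    .inl (.inl ⟨z, rfl, rfl⟩)⟩)
  exact D.pair_ne z
    (Sum.map_injective.2 ⟨Function.injective_id, Sum.inl_injective⟩ h).symm

theorem reachable_upper (E : Diagram n p) (D : Diagram m n) (z : Fin n ⊕ Fin p) :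
    (Diagram.stack E D).Reachable (Sum.inr z) (Sum.inr (E.pair z)) := by
  refine SimpleGraph.Adj.reachable ((SimpleGraph.fromRel_adj _ _ _).2 ⟨fun h => ?_,
    .inl (.inr ⟨z, rfl, rfl⟩)⟩)
  exact E.pair_ne z (Sum.inr_injective h).symm

/-- A colouring of all sites of the picture from colourings of the three rows. -/
def rows (x : Fin m → Bool) (z : Fin n → Bool) (y : Fin p → Bool) :
    Fin m ⊕ (Fin n ⊕ Fin p) → Bool :=
  Sum.elim x (Sum.elim z y)

theorem rows_lower (x : Fin m → Bool) (z : Fin n → Bool) (y : Fin p → Bool) (s : Fin m ⊕ Fin n) :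
    rows x z y (Sum.map id Sum.inl s) = Sum.elim x z s := by
  rcases s with s | s <;> rfl

theorem rows_outer (x : Fin m → Bool) (z : Fin n → Bool) (y : Fin p → Bool) (s : Fin m ⊕ Fin p) :
    rows x z y (Sum.map id Sum.inr s) = Sum.elim x y s := by
  rcases s with s | s <;> rfl

theorem rows_eq_of_reachable {x : Fin m → Bool} {z : Fin n → Bool} {y : Fin p → Bool}
    (hD : Compat D x z) (hE : Compat E z y) {u v : Fin m ⊕ (Fin n ⊕ Fin p)}
    (h : (Diagram.stack E D).Reachable u v) : rows x z y u = rows x z y v := by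
  obtain ⟨w⟩ := h
  induction w with
  | nil => rfl
  | cons hadj _ ih =>
    rw [← ih]
    obtain ⟨-, (⟨s, rfl, rfl⟩ | ⟨s, rfl, rfl⟩) | (⟨s, rfl, rfl⟩ | ⟨s, rfl, rfl⟩)⟩ :=
      (SimpleGraph.fromRel_adj _ _ _).1 hadj
    · rw [rows_lower, rows_lower, hD s]
    · exact (hE s).symm
    · rw [rows_lower, rows_lower, hD s]
    · exact hE s

theorem compat_of_reachable {w : Fin m ⊕ (Fin n ⊕ Fin p) → Bool}
    (h : ∀ u v, (Diagram.stack E D).Reachable u v → w u = w v) :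
    Compat D (fun i => w (.inl i)) (fun i => w (.inr (.inl i))) ∧
      Compat E (fun i => w (.inr (.inl i))) (fun i => w (.inr (.inr i))) := by
  have h1 : Sum.elim (fun i => w (.inl i)) (fun i => w (.inr (.inl i))) =
      w ∘ Sum.map id Sum.inl := by ext (s | s) <;> rfl
  have h2 : Sum.elim (fun i => w (.inr (.inl i))) (fun i => w (.inr (.inr i))) =
      w ∘ Sum.inr := by ext (s | s) <;> rfl
  constructor
  · intro s
    rw [h1]
    exact (h _ _ (reachable_lower E D s)).symm
  · intro s
    rw [h2]
    exact (h _ _ (reachable_upper E D s)).symm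

theorem Compat.eq_of_mem {x : Fin m → Bool} {y : Fin n → Bool} (h : Compat D x y)
    {s t : Fin m ⊕ Fin n} (hst : D.pair s = t) : Sum.elim x y s = Sum.elim x y t := by
  rw [← hst, h]

open Classical in
theorem elim_line (s s' : Fin m ⊕ Fin n) :
    Sum.elim (fun i => decide (Sum.inl i = s ∨ Sum.inl i = s'))
      (fun j => decide (Sum.inr j = s ∨ Sum.inr j = s')) =
      fun t => decide (t = s ∨ t = s') := by
  ext (t | t) <;> rfl

open Classical in
/-- The colouring for which exactly the two ends of one line have the colour `true`. -/
theorem compat_line (D : Diagram m n) (s : Fin m ⊕ Fin n) :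
    Compat D (fun i => decide (Sum.inl i = s ∨ Sum.inl i = D.pair s))
      (fun j => decide (Sum.inr j = s ∨ Sum.inr j = D.pair s)) := by
  intro t
  rw [elim_line]
  have h1 : D.pair t = s ↔ t = D.pair s :=
    ⟨fun h => by rw [← h, D.pair_pair], fun h => by rw [h, D.pair_pair]⟩
  have h2 : D.pair t = D.pair s ↔ t = s :=
    ⟨fun h => by rw [← D.pair_pair t, h, D.pair_pair], fun h => by rw [h]⟩
  simp only [h1, h2, or_comm]

/-- Concatenation of diagrams is composition of relations: two outer sites are connected in the
picture if and only if no colouring separates them. -/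
theorem isConcat_of_compat (h : ∀ x y, Compat F x y ↔ ∃ z, Compat D x z ∧ Compat E z y) :
    Diagram.IsConcat E D F := by
  classical
  intro s t
  constructor
  · rintro rfl
    refine ⟨(F.pair_ne s).symm, ?_⟩
    -- colour the component of `s`
    let w : Fin m ⊕ (Fin n ⊕ Fin p) → Bool := fun v =>
      decide ((Diagram.stack E D).Reachable (Sum.map id Sum.inr s) v)
    have hw : ∀ u v, (Diagram.stack E D).Reachable u v → w u = w v := fun u v huv =>
      decide_eq_decide.2 ⟨fun h => h.trans huv, fun h => h.trans huv.symm⟩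
    have hc := (h _ _).2 ⟨_, compat_of_reachable hw⟩
    have h1 : Sum.elim (fun i => w (.inl i)) (fun i => w (.inr (.inr i))) =
        w ∘ Sum.map id Sum.inr := by ext (s | s) <;> rfl
    have h2 := hc s
    rw [h1] at h2
    have h3 : w (Sum.map id Sum.inr s) = true := decide_eq_true (SimpleGraph.Reachable.refl _)
    exact of_decide_eq_true (h2.trans h3)
  · rintro ⟨hne, hr⟩
    obtain ⟨z, hD, hE⟩ := (h _ _).1 (compat_line F s)
    have h1 := rows_eq_of_reachable hD hE hr
    rw [rows_outer, rows_outer] at h1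
    rw [elim_line] at h1
    simp only [true_or, decide_true] at h1
    rcases of_decide_eq_true h1.symm with h | h
    · exact absurd h.symm hne
    · exact h.symm

theorem exists_isConcat (E : Diagram n p) (D : Diagram m n) : ∃ F, Diagram.IsConcat E D F := by
  obtain ⟨F, hF⟩ := exists_compat_comp E D
  exact ⟨F, isConcat_of_compat hF⟩

theorem isConcat_unique {F' : Diagram m p} (h : Diagram.IsConcat E D F)
    (h' : Diagram.IsConcat E D F') : F = F' := by
  ext1; ext1 s
  exact ((h' s _).2 ((h s _).1 rfl)).symm

/-- For a fixed colouring of the outer sites, every closed loop may be coloured freely, and nothing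
else in the middle is free. -/
theorem card_compat (hF : Diagram.IsConcat E D F) {x : Fin m → Bool} {y : Fin p → Bool}
    (hxy : Compat F x y) :
    Nat.card {z // Compat D x z ∧ Compat E z y} = 2 ^ Diagram.loops E D := by
  classical
  let L := {C : (Diagram.stack E D).ConnectedComponent //
    ∀ v ∈ C.supp, ∃ j : Fin n, v = .inr (.inl j)}
  have outer : ∀ s t : Fin m ⊕ Fin p, (Diagram.stack E D).Reachable (Sum.map id Sum.inr s)
      (Sum.map id Sum.inr t) → Sum.elim x y s = Sum.elim x y t := by
    intro s t h
    by_cases hst : s = t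
    · rw [hst]
    · exact hxy.eq_of_mem ((hF s t).2 ⟨hst, h⟩)
  have notLoop : ∀ C : (Diagram.stack E D).ConnectedComponent,
      (¬ ∀ v ∈ C.supp, ∃ j : Fin n, v = .inr (.inl j)) →
      ∃ s : Fin m ⊕ Fin p,
        (Diagram.stack E D).connectedComponentMk (Sum.map id Sum.inr s) = C := by
    intro C hC
    push Not at hC
    obtain ⟨v, hv, hj⟩ := hC
    rcases v with i | j | i
    · exact ⟨.inl i, hv⟩
    · exact absurd rfl (hj j)
    · exact ⟨.inr i, hv⟩
  let φ : {z // Compat D x z ∧ Compat E z y} → (L → Bool) := fun z C => rows x z.1 y C.1.out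
  have hφ : Function.Bijective φ := by
    constructor
    · intro z z' h
      apply Subtype.ext
      ext1 j
      by_cases hC : ∀ v ∈ ((Diagram.stack E D).connectedComponentMk (.inr (.inl j))).supp,
          ∃ j : Fin n, v = .inr (.inl j)
      · have h1 := congrFun h ⟨_, hC⟩
        have h2 : (Diagram.stack E D).Reachable
            ((Diagram.stack E D).connectedComponentMk (.inr (.inl j))).out (.inr (.inl j)) :=
          SimpleGraph.ConnectedComponent.exact (Quot.out_eq _)
        have h3 := rows_eq_of_reachable z.2.1 z.2.2 h2
        have h4 := rows_eq_of_reachable z'.2.1 z'.2.2 h2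
        exact h3.symm.trans (h1.trans h4)
      · obtain ⟨s, hs⟩ := notLoop _ hC
        have h2 := SimpleGraph.ConnectedComponent.exact hs
        have h3 := rows_eq_of_reachable z.2.1 z.2.2 h2
        have h4 := rows_eq_of_reachable z'.2.1 z'.2.2 h2
        rw [rows_outer] at h3 h4
        exact h3.symm.trans h4
    · intro g
      let W : (Diagram.stack E D).ConnectedComponent → Bool := fun C =>
        if h : ∀ v ∈ C.supp, ∃ j : Fin n, v = .inr (.inl j) then g ⟨C, h⟩
        else Sum.elim x y (notLoop C h).choose
      let w : Fin m ⊕ (Fin n ⊕ Fin p) → Bool := fun v =>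
        W ((Diagram.stack E D).connectedComponentMk v)
      have hw : ∀ u v, (Diagram.stack E D).Reachable u v → w u = w v := fun u v huv =>
        congrArg W (SimpleGraph.ConnectedComponent.sound huv)
      have hwo : ∀ s : Fin m ⊕ Fin p, w (Sum.map id Sum.inr s) = Sum.elim x y s := by
        intro s
        have hn : ¬ ∀ v ∈ ((Diagram.stack E D).connectedComponentMk (Sum.map id Sum.inr s)).supp,
            ∃ j : Fin n, v = .inr (.inl j) := fun h => by
          obtain ⟨j, hj⟩ := h _ rfl
          rcases s with s | s <;> simp at hj
        simp only [w, W, dif_neg hn]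
        exact outer _ _ (SimpleGraph.ConnectedComponent.exact (notLoop _ hn).choose_spec)
      have hc := compat_of_reachable hw
      have ex : (fun i => w (.inl i)) = x := funext fun i => hwo (.inl i)
      have ey : (fun i => w (.inr (.inr i))) = y := funext fun i => hwo (.inr i)
      rw [ex, ey] at hc
      refine ⟨⟨_, hc⟩, funext fun C => ?_⟩
      have ew : rows x (fun i => w (.inr (.inl i))) y = w := by
        ext (i | i | i)
        · exact (congrFun ex i).symm
        · rfl
        · exact (congrFun ey i).symm
      simp only [φ, ew]
      have h1 : (Diagram.stack E D).connectedComponentMk C.1.out = C.1 := Quot.out_eq _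
      simp only [w, W, h1, dif_pos C.2]
      rfl
  rw [Nat.card_congr (Equiv.ofBijective φ hφ), Nat.card_fun]
  simp [L, Diagram.loops]

end Stack

/-! ### The matrix of a diagram -/

section Matrix

variable {m n p : ℕ}

open Classical in
/-- The matrix of the relation between colourings given by a diagram. -/
noncomputable def mat (D : Diagram m n) : Matrix (Fin m → Bool) (Fin n → Bool) ℕ :=
  Matrix.of fun x y => if Compat D x y then 1 else 0

open Classical in
theorem mat_apply (D : Diagram m n) (x : Fin m → Bool) (y : Fin n → Bool) :
    mat D x y = if Compat D x y then 1 else 0 := rfl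

theorem mat_mul {E : Diagram n p} {D : Diagram m n} {F : Diagram m p}
    (hF : Diagram.IsConcat E D F) : mat D * mat E = 2 ^ Diagram.loops E D • mat F := by
  classical
  ext x y
  rw [Matrix.mul_apply, Matrix.smul_apply, mat_apply F]
  have h1 : ∑ z, mat D x z * mat E z y = Nat.card {z // Compat D x z ∧ Compat E z y} := by
    rw [Nat.card_eq_fintype_card, Fintype.card_subtype, Finset.card_filter]
    refine Finset.sum_congr rfl fun z _ => ?_
    simp only [mat_apply, ite_and, mul_ite, mul_one, mul_zero]
    split_ifs <;> rfl
  rw [h1]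
  split_ifs with h
  · rw [card_compat hF h, smul_eq_mul, mul_one]
  · rw [smul_zero, Finite.card_eq_zero_iff]
    refine ⟨fun z => h fun s => ?_⟩
    have := rows_eq_of_reachable z.2.1 z.2.2 ((hF s _).1 rfl).2
    rw [rows_outer, rows_outer] at this
    exact this.symm

theorem mat_eq_iff {D D' : Diagram m n} {a b : ℕ} (h : 2 ^ a • mat D = 2 ^ b • mat D') :
    a = b ∧ D = D' := by
  classical
  have hc : ∀ D : Diagram m n, Compat D (fun _ => true) (fun _ => true) := by
    intro D s
    have : Sum.elim (fun _ : Fin m => true) (fun _ : Fin n => true) = fun _ => true := by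
      ext (s | s) <;> rfl
    rw [this]
  have hab : a = b := by
    have := congrFun (congrFun h fun _ => true) fun _ => true
    simp only [Matrix.smul_apply, mat_apply, if_pos (hc _), smul_eq_mul, mul_one] at this
    exact Nat.pow_right_injective le_rfl this
  refine ⟨hab, ?_⟩
  subst hab
  ext1; ext1 s
  have h1 := congrFun (congrFun h _) _ |>.symm.trans
    (congrArg (2 ^ a • ·) ((mat_apply D _ _).trans (if_pos (compat_line D s))))
  simp only [Matrix.smul_apply, mat_apply, smul_eq_mul, mul_one] at h1
  have h2 : Compat D' (fun i => decide (Sum.inl i = s ∨ Sum.inl i = D.pair s))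
      (fun j => decide (Sum.inr j = s ∨ Sum.inr j = D.pair s)) := by
    by_contra hn
    rw [if_neg hn, mul_zero] at h1
    exact absurd h1.symm (by positivity)
  have h4 := h2 s
  rw [elim_line] at h4
  simp only [true_or, decide_true] at h4
  rcases of_decide_eq_true h4 with h | h
  · exact absurd h (D'.pair_ne s)
  · exact h.symm

theorem compat_idn (x y : Fin n → Bool) : Compat (Diagram.idn n) x y ↔ x = y := by
  constructor
  · intro h; ext1 i; exact h (.inr i)
  · rintro rfl (i | i) <;> rfl

theorem mat_idn : mat (Diagram.idn n) = 1 := by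
  classical
  ext x y
  rw [mat_apply, Matrix.one_apply, if_congr (compat_idn x y) rfl rfl]

theorem compat_flip (D : Diagram m n) (x : Fin n → Bool) (y : Fin m → Bool) :
    Compat D.flip x y ↔ Compat D y x := by
  have e : ∀ s : Fin n ⊕ Fin m, Sum.elim x y s = Sum.elim y x s.swap := by
    rintro (s | s) <;> rfl
  constructor
  · intro h s
    have := h s.swap
    rw [e, e] at this
    simpa [Diagram.flip] using this
  · intro h s
    rw [e, e]
    simpa [Diagram.flip] using h s.swap

theorem mat_flip (D : Diagram m n) : mat D.flip = (mat D).transpose := by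
  classical
  ext x y
  rw [Matrix.transpose_apply, mat_apply, mat_apply, if_congr (compat_flip D x y) rfl rfl]

end Matrix

/-! ### The Temperley--Lieb category -/

section Category

variable {k : Type*} [CommRing k] {m n p q : ℕ}

theorem hom_induction {P : Hom k m n → Prop} (h0 : P 0) (hadd : ∀ f g, P f → P g → P (f + g))
    (hs : ∀ (c : k) (D : Diagram m n), P (c • ofDiagram D)) (f : Hom k m n) : P f := by
  induction f using Finsupp.induction_linear with
  | zero => exact h0
  | add f g hf hg => exact hadd f g hf hg
  | single D c => simpa [ofDiagram] using hs c D

theorem comp_ofDiagram (δ : k) (E : Diagram n p) (D : Diagram m n) :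
    comp δ (ofDiagram E) (ofDiagram D) = compDiagram δ E D := by
  simp [comp, ofDiagram]

theorem tensorHom_ofDiagram {m' n' : ℕ} (D : Diagram m n) (E : Diagram m' n') :
    tensorHom (ofDiagram D) (ofDiagram E) = (ofDiagram (D.tensor E) : Hom k _ _) := by
  simp [tensorHom, ofDiagram]

theorem flipHom_ofDiagram (D : Diagram m n) :
    flipHom (ofDiagram D) = (ofDiagram D.flip : Hom k _ _) := by
  simp [flipHom, ofDiagram]

theorem compDiagram_eq (δ : k) {E : Diagram n p} {D : Diagram m n} {F : Diagram m p}
    (h : Diagram.IsConcat E D F) :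
    compDiagram δ E D = δ ^ Diagram.loops E D • ofDiagram F := by
  classical
  rw [compDiagram, Finset.sum_eq_single F, if_pos h]
  · exact fun F' _ hne => if_neg fun h' => hne (isConcat_unique h' h)
  · exact fun h => absurd (Finset.mem_univ F) h

theorem isConcat_of_mat {E : Diagram n p} {D : Diagram m n} {F : Diagram m p} {a : ℕ}
    (h : mat D * mat E = 2 ^ a • mat F) :
    Diagram.IsConcat E D F ∧ Diagram.loops E D = a := by
  obtain ⟨F', hF'⟩ := exists_isConcat E D
  rw [mat_mul hF'] at h
  obtain ⟨h1, rfl⟩ := mat_eq_iff h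
  exact ⟨hF', h1⟩

/-- An equation between matrices of diagrams computes their composition. -/
theorem comp_ofDiagram_of_mat (δ : k) {E : Diagram n p} {D : Diagram m n} {F : Diagram m p}
    {a : ℕ} (h : mat D * mat E = 2 ^ a • mat F) :
    comp δ (ofDiagram E) (ofDiagram D) = δ ^ a • ofDiagram F := by
  obtain ⟨h1, h2⟩ := isConcat_of_mat h
  rw [comp_ofDiagram, compDiagram_eq δ h1, h2]

theorem comp_ofDiagram_of_mat_eq (δ : k) {E : Diagram n p} {D : Diagram m n} {F : Diagram m p}
    (h : mat D * mat E = mat F) : comp δ (ofDiagram E) (ofDiagram D) = ofDiagram F := by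
  have := comp_ofDiagram_of_mat δ (a := 0) (h.trans (one_smul ℕ _).symm)
  rwa [pow_zero, one_smul] at this

theorem comp_assoc (δ : k) (f : Hom k p q) (g : Hom k n p) (h : Hom k m n) :
    comp δ (comp δ f g) h = comp δ f (comp δ g h) := by
  induction f using hom_induction with
  | h0 => simp
  | hadd f f' hf hf' => simp only [map_add, LinearMap.add_apply, hf, hf']
  | hs c C =>
  induction g using hom_induction with
  | h0 => simp
  | hadd f f' hf hf' => simp only [map_add, LinearMap.add_apply, hf, hf']
  | hs d D =>
  induction h using hom_induction with
  | h0 => simp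
  | hadd f f' hf hf' => simp only [map_add, hf, hf']
  | hs e E =>
  simp only [map_smul, LinearMap.smul_apply]
  congr 3
  obtain ⟨F, hF⟩ := exists_isConcat C D
  obtain ⟨F', hF'⟩ := exists_isConcat D E
  obtain ⟨H, hH⟩ := exists_isConcat F E
  obtain ⟨H', hH'⟩ := exists_isConcat C F'
  have h : 2 ^ (Diagram.loops C D + Diagram.loops F E) • mat H =
      2 ^ (Diagram.loops D E + Diagram.loops C F') • mat H' := by
    rw [pow_add, pow_add, mul_smul, mul_smul, ← mat_mul hH, ← mat_mul hH', ← Matrix.mul_smul,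
      ← mat_mul hF, ← Matrix.mul_assoc, mat_mul hF', Matrix.smul_mul]
  obtain ⟨h1, rfl⟩ := mat_eq_iff h
  rw [comp_ofDiagram δ C D, comp_ofDiagram δ D E, compDiagram_eq δ hF, compDiagram_eq δ hF',
    map_smul, map_smul, LinearMap.smul_apply, comp_ofDiagram, comp_ofDiagram, compDiagram_eq δ hH,
    compDiagram_eq δ hH', smul_smul, smul_smul, ← pow_add, ← pow_add, h1]

theorem id_comp (δ : k) (f : Hom k m n) : comp δ (idHom k n) f = f := by
  induction f using hom_induction with
  | h0 => simp
  | hadd f f' hf hf' => rw [map_add, hf, hf']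
  | hs c C =>
    rw [map_smul, idHom, comp_ofDiagram_of_mat_eq δ]
    rw [mat_idn, Matrix.mul_one]

theorem comp_id (δ : k) (f : Hom k m n) : comp δ f (idHom k m) = f := by
  induction f using hom_induction with
  | h0 => simp
  | hadd f f' hf hf' => rw [map_add, LinearMap.add_apply, hf, hf']
  | hs c C =>
    rw [map_smul, LinearMap.smul_apply, idHom, comp_ofDiagram_of_mat_eq δ]
    rw [mat_idn, Matrix.one_mul]

theorem flip_flip (D : Diagram m n) : D.flip.flip = D := by
  ext1; ext1 s; simp [Diagram.flip]

theorem flipHom_flipHom (f : Hom k m n) : flipHom (flipHom f) = f := by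
  induction f using hom_induction with
  | h0 => simp
  | hadd f f' hf hf' => rw [map_add, map_add, hf, hf']
  | hs c C =>
    rw [map_smul, map_smul, flipHom_ofDiagram, flipHom_ofDiagram, flip_flip]

theorem flipHom_comp (δ : k) (f : Hom k n p) (g : Hom k m n) :
    flipHom (comp δ f g) = comp δ (flipHom g) (flipHom f) := by
  induction f using hom_induction with
  | h0 => simp
  | hadd f f' hf hf' => simp only [map_add, LinearMap.add_apply, hf, hf']
  | hs c C =>
  induction g using hom_induction with
  | h0 => simp
  | hadd f f' hf hf' => simp only [map_add, LinearMap.add_apply, hf, hf']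
  | hs d D =>
  obtain ⟨F, hF⟩ := exists_isConcat C D
  have h := congrArg Matrix.transpose (mat_mul hF)
  rw [Matrix.transpose_mul, Matrix.transpose_smul, ← mat_flip, ← mat_flip, ← mat_flip] at h
  simp only [map_smul, LinearMap.smul_apply, flipHom_ofDiagram, comp_ofDiagram_of_mat δ h]
  rw [comp_ofDiagram, compDiagram_eq δ hF, map_smul, flipHom_ofDiagram, smul_comm c d]

end Category

/-! ### Through degree -/

section ThroughDegree

variable {k : Type*} [CommRing k] {m n p : ℕ}

theorem isConcat_flip {E : Diagram n p} {D : Diagram m n} {F : Diagram m p}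
    (hF : Diagram.IsConcat E D F) : Diagram.IsConcat D.flip E.flip F.flip := by
  have h := congrArg Matrix.transpose (mat_mul hF)
  rw [Matrix.transpose_mul, Matrix.transpose_smul, ← mat_flip, ← mat_flip, ← mat_flip] at h
  exact (isConcat_of_mat h).1

theorem concat_pair_of_arc {E : Diagram n p} {D : Diagram m n} {F : Diagram m p}
    (hF : Diagram.IsConcat E D F) {i j : Fin m} (h : D.pair (.inl i) = .inl j) :
    F.pair (.inl i) = .inl j := by
  refine (hF _ _).2 ⟨?_, ?_⟩
  · intro h'
    have e : i = j := Sum.inl_injective h'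
    exact D.pair_ne _ (e ▸ h)
  · have := reachable_lower E D (.inl i)
    rw [h] at this
    exact this

theorem concat_pair_of_through {E : Diagram n p} {D : Diagram m n} {F : Diagram m p}
    (hF : Diagram.IsConcat E D F) {i : Fin m} {j : Fin n} {l : Fin p}
    (h : D.pair (.inl i) = .inr j) (h' : E.pair (.inl j) = .inr l) :
    F.pair (.inl i) = .inr l := by
  refine (hF _ _).2 ⟨by simp, ?_⟩
  have h1 := reachable_lower E D (.inl i)
  have h2 := reachable_upper E D (.inl j)
  rw [h] at h1
  rw [h'] at h2
  exact h1.trans h2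

theorem flip_pair_inl {D : Diagram m n} {j : Fin n} {i : Fin m} :
    D.flip.pair (.inl j) = .inr i ↔ D.pair (.inl i) = .inr j := by
  have e : D.flip.pair (.inl j) = (D.pair (.inr j)).swap := rfl
  rw [e]
  constructor
  · intro h
    have h' : D.pair (.inr j) = .inl i := by
      rw [← Sum.swap_swap (D.pair _), h, Sum.swap_inr]
    rw [← h', D.pair_pair]
  · intro h
    rw [← h, D.pair_pair, Sum.swap_inl]

theorem throughDegree_flip (D : Diagram m n) : D.flip.throughDegree = D.throughDegree := by
  have key : ∀ {m n : ℕ} (D : Diagram m n), D.flip.throughDegree ≤ D.throughDegree := by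
    intro m n D
    refine Nat.card_le_card_of_injective (fun j : {j // ∃ i, D.flip.pair (.inl j) = .inr i} =>
      (⟨j.2.choose, j, flip_pair_inl.1 j.2.choose_spec⟩ : {i // ∃ j, D.pair (.inl i) = .inr j}))
      fun j j' h => ?_
    have h1 := flip_pair_inl.1 j.2.choose_spec
    have h2 := flip_pair_inl.1 j'.2.choose_spec
    have e : j.2.choose = j'.2.choose := congrArg Subtype.val h
    rw [e, h2] at h1
    exact Subtype.ext (Sum.inr_injective h1).symm
  refine le_antisymm (key D) ?_
  have := key D.flip
  rwa [flip_flip] at this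

theorem throughDegree_concat_le_right {E : Diagram n p} {D : Diagram m n} {F : Diagram m p}
    (hF : Diagram.IsConcat E D F) : F.throughDegree ≤ D.throughDegree := by
  have h : ∀ i : Fin m, (∃ j, F.pair (.inl i) = .inr j) → ∃ j, D.pair (.inl i) = .inr j := by
    rintro i ⟨j, hj⟩
    rcases h : D.pair (.inl i) with i' | j'
    · rw [concat_pair_of_arc hF h] at hj; simp at hj
    · exact ⟨j', rfl⟩
  exact Nat.card_le_card_of_injective (fun i => (⟨i.1, h i.1 i.2⟩ : {i // ∃ j, D.pair _ = _}))
    fun i i' h => Subtype.ext (Subtype.mk.inj h)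

theorem tdLT_eq_span (l : ℕ) : (tdLT k l : Submodule k (Hom k m n)) =
    Submodule.span k (ofDiagram '' {D : Diagram m n | D.throughDegree < l}) :=
  Finsupp.supported_eq_span_single k _

theorem ofDiagram_mem_tdLT {D : Diagram m n} {l : ℕ} (h : D.throughDegree < l) :
    (ofDiagram D : Hom k m n) ∈ tdLT k l := by
  rw [tdLT_eq_span]
  exact Submodule.subset_span ⟨D, h, rfl⟩

theorem tdLT_induction {l : ℕ} {m' n' : ℕ} {N : Submodule k (Hom k m' n')}
    {T : Hom k m n →ₗ[k] Hom k m' n'}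
    (h : ∀ D : Diagram m n, D.throughDegree < l → T (ofDiagram D) ∈ N) {f : Hom k m n}
    (hf : f ∈ tdLT k l) : T f ∈ N := by
  rw [tdLT_eq_span] at hf
  have : Submodule.span k (ofDiagram '' {D : Diagram m n | D.throughDegree < l}) ≤ N.comap T := by
    rw [Submodule.span_le]
    rintro _ ⟨D, hD, rfl⟩
    exact h D hD
  exact this hf

theorem comp_mem_tdLT_right (δ : k) {l : ℕ} (f : Hom k n p) {g : Hom k m n}
    (hg : g ∈ tdLT k l) : comp δ f g ∈ tdLT k l := by
  induction f using hom_induction with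
  | h0 => simp
  | hadd f f' hf hf' => rw [map_add]; exact add_mem hf hf'
  | hs c C =>
    refine tdLT_induction (T := comp δ (c • ofDiagram C)) (fun D hD => ?_) hg
    obtain ⟨F, hF⟩ := exists_isConcat C D
    rw [map_smul, LinearMap.smul_apply, comp_ofDiagram, compDiagram_eq δ hF]
    exact Submodule.smul_mem _ _ (Submodule.smul_mem _ _ (ofDiagram_mem_tdLT
      ((throughDegree_concat_le_right hF).trans_lt hD)))

theorem flipHom_mem_tdLT {l : ℕ} {f : Hom k m n} (hf : f ∈ tdLT k l) :
    flipHom f ∈ tdLT k l :=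
  tdLT_induction (fun D hD => by
    rw [flipHom_ofDiagram]
    exact ofDiagram_mem_tdLT (by rwa [throughDegree_flip])) hf

theorem comp_mem_tdLT_left (δ : k) {l : ℕ} {f : Hom k n p} (g : Hom k m n)
    (hf : f ∈ tdLT k l) : comp δ f g ∈ tdLT k l := by
  rw [← flipHom_flipHom (comp δ f g), flipHom_comp]
  exact flipHom_mem_tdLT (comp_mem_tdLT_right δ _ (flipHom_mem_tdLT hf))

end ThroughDegree

/-! ### Adding a vertical line and bending a line -/

section Bend

variable {m n p l : ℕ}

theorem compat_tensor {m' n' : ℕ} (D : Diagram m n) (E : Diagram m' n') (x : Fin m → Bool)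
    (x' : Fin m' → Bool) (y : Fin n → Bool) (y' : Fin n' → Bool) :
    Compat (D.tensor E) (Fin.append x x') (Fin.append y y') ↔ Compat D x y ∧ Compat E x' y' := by
  have e : ∀ s, Sum.elim (Fin.append x x') (Fin.append y y') (Diagram.sites m m' n n' s) =
      Sum.elim (Sum.elim x y) (Sum.elim x' y') s := by
    rintro ((s | s) | (s | s)) <;> simp [Diagram.sites, Equiv.sumSumSumComm]
  have e' : ∀ s, (D.tensor E).pair (Diagram.sites m m' n n' s) =
      Diagram.sites m m' n n' (Sum.map D.pair E.pair s) := by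
    intro s; simp [Diagram.tensor]
  constructor
  · intro h
    constructor
    · intro s
      have := h (Diagram.sites m m' n n' (.inl s))
      rwa [e', e, e] at this
    · intro s
      have := h (Diagram.sites m m' n n' (.inr s))
      rwa [e', e, e] at this
  · rintro ⟨h1, h2⟩ s
    obtain ⟨s, rfl⟩ := (Diagram.sites m m' n n').surjective s
    rw [e', e, e]
    rcases s with s | s
    · exact h1 s
    · exact h2 s

/-- The diagram with an additional vertical line on the right. -/
def addLine (D : Diagram m n) : Diagram (m + 1) (n + 1) := D.tensor (Diagram.idn 1)

theorem addLine_pair (D : Diagram m n) (s : Fin m ⊕ Fin n) :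
    (addLine D).pair (Sum.map Fin.castSucc Fin.castSucc s) =
      Sum.map Fin.castSucc Fin.castSucc (D.pair s) := by
  have e : ∀ s, Sum.map Fin.castSucc Fin.castSucc s = Diagram.sites m 1 n 1 (.inl s) := by
    rintro (s | s) <;> rfl
  rw [e, e, addLine, Diagram.tensor]
  simp

theorem addLine_pair_last (D : Diagram m n) :
    (addLine D).pair (.inl (Fin.last m)) = .inr (Fin.last n) := by
  have e1 : Sum.inl (Fin.last m) = Diagram.sites m 1 n 1 (.inr (.inl 0)) := rfl
  have e2 : Sum.inr (Fin.last n) = Diagram.sites m 1 n 1 (.inr (.inr 0)) := rfl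
  rw [e1, e2, addLine, Diagram.tensor]
  simp [Diagram.idn]

/-- Moving the rightmost top site to the bottom. -/
def bendEquiv (n l : ℕ) : Fin n ⊕ Fin (l + 1) ≃ Fin (n + 1) ⊕ Fin l where
  toFun := Sum.elim (fun i => .inl i.castSucc) (Fin.lastCases (.inl (Fin.last n)) .inr)
  invFun := Sum.elim (Fin.lastCases (.inr (Fin.last l)) .inl) (fun j => .inr j.castSucc)
  left_inv := by
    rintro (i | j)
    · simp
    · refine Fin.lastCases ?_ (fun j => ?_) j <;> simp
  right_inv := by
    rintro (i | j)
    · refine Fin.lastCases ?_ (fun j => ?_) i <;> simp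
    · simp

theorem bendEquiv_inl (i : Fin n) : bendEquiv n l (.inl i) = .inl i.castSucc := rfl

theorem bendEquiv_inr (j : Fin l) : bendEquiv n l (.inr j.castSucc) = .inr j := by
  simp [bendEquiv]

theorem bendEquiv_last : bendEquiv n l (.inr (Fin.last l)) = .inl (Fin.last n) := by
  simp [bendEquiv]

theorem pos_bendEquiv (s : Fin n ⊕ Fin (l + 1)) : pos (bendEquiv n l s) = pos s := by
  rcases s with i | j
  · rfl
  · refine Fin.lastCases ?_ (fun j => ?_) j
    · rw [bendEquiv_last]; simp [pos]
    · rw [bendEquiv_inr]; simp only [pos, Fin.val_castSucc]; omega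

/-- Bending down the line that ends in the rightmost top site. -/
def bendDown (D : Diagram n (l + 1)) : Diagram (n + 1) l where
  pair s := bendEquiv n l (D.pair ((bendEquiv n l).symm s))
  pair_pair s := by simp [D.pair_pair]
  pair_ne s h := D.pair_ne _ ((Equiv.eq_symm_apply _).2 h)
  planar s t := by
    have := D.planar ((bendEquiv n l).symm s) ((bendEquiv n l).symm t)
    rw [← pos_bendEquiv, ← pos_bendEquiv ((bendEquiv n l).symm t), ← pos_bendEquiv (D.pair _),
      ← pos_bendEquiv (D.pair _)] at this
    simpa using this

theorem bendDown_pair (D : Diagram n (l + 1)) (s : Fin n ⊕ Fin (l + 1)) :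
    (bendDown D).pair (bendEquiv n l s) = bendEquiv n l (D.pair s) := by
  simp [bendDown]

theorem bendDown_surjective : Function.Surjective (bendDown : Diagram n (l + 1) → _) := by
  intro D
  refine ⟨⟨fun s => (bendEquiv n l).symm (D.pair (bendEquiv n l s)), ?_, ?_, ?_⟩, ?_⟩
  · intro s; simp [D.pair_pair]
  · intro s h; exact D.pair_ne _ ((Equiv.symm_apply_eq _).1 h)
  · intro s t
    rw [← pos_bendEquiv, ← pos_bendEquiv t, ← pos_bendEquiv ((bendEquiv n l).symm _),
      ← pos_bendEquiv ((bendEquiv n l).symm _), Equiv.apply_symm_apply, Equiv.apply_symm_apply]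
    exact D.planar _ _
  · ext1; ext1 s; simp [bendDown]

theorem compat_addLine (D : Diagram m n) (x : Fin m → Bool) (y : Fin n → Bool) (a b : Bool) :
    Compat (addLine D) (Fin.snoc x a : Fin (m + 1) → Bool) (Fin.snoc y b : Fin (n + 1) → Bool) ↔
      Compat D x y ∧ a = b := by
  have h := compat_tensor D (Diagram.idn 1) x (fun _ => a) y (fun _ => b)
  rw [compat_idn, Fin.append_right_eq_snoc, Fin.append_right_eq_snoc] at h
  rw [addLine, h, funext_iff]
  simp

theorem compat_bendDown (D : Diagram n (l + 1)) (x : Fin n → Bool) (y : Fin l → Bool) (a : Bool) :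
    Compat (bendDown D) (Fin.snoc x a : Fin (n + 1) → Bool) y ↔
      Compat D x (Fin.snoc y a : Fin (l + 1) → Bool) := by
  have e : ∀ s, Sum.elim (Fin.snoc x a : Fin (n + 1) → Bool) y (bendEquiv n l s) =
      Sum.elim x (Fin.snoc y a : Fin (l + 1) → Bool) s := by
    rintro (i | j)
    · simp [bendEquiv_inl]
    · refine Fin.lastCases ?_ (fun j => ?_) j
      · simp [bendEquiv_last]
      · simp [bendEquiv_inr]
  constructor
  · intro h s
    have := h (bendEquiv n l s)
    rwa [bendDown_pair, e, e] at this
  · intro h s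
    obtain ⟨s, rfl⟩ := (bendEquiv n l).surjective s
    rw [bendDown_pair, e, e]
    exact h s

/-- The morphism `id_l ⊗ cap`. -/
def capRight (l : ℕ) : Diagram (l + 1 + 1) l := (Diagram.idn l).tensor Diagram.cap

theorem compat_cap (a b : Bool) (y : Fin 0 → Bool) :
    Compat Diagram.cap ![a, b] y ↔ a = b := by
  constructor
  · intro h; exact (h (.inl 0)).symm
  · rintro rfl (i | i)
    · fin_cases i <;> rfl
    · exact i.elim0

theorem compat_capRight (z : Fin l → Bool) (a b : Bool) (y : Fin l → Bool) :
    Compat (capRight l) (Fin.snoc (Fin.snoc z a : Fin (l + 1) → Bool) b : Fin (l + 1 + 1) → Bool) y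
      ↔ z = y ∧ a = b := by
  have h := compat_tensor (Diagram.idn l) Diagram.cap z ![a, b] y Fin.elim0
  rw [compat_idn, compat_cap, Fin.append_elim0] at h
  rw [← h, capRight]
  have : (Fin.snoc (Fin.snoc z a : Fin (l + 1) → Bool) b : Fin (l + 1 + 1) → Bool) =
      Fin.append z ![a, b] := by
    ext i
    refine Fin.lastCases ?_ (fun i => Fin.lastCases ?_ (fun i => ?_) i) i
    · rw [Fin.snoc_last]
      exact (Fin.append_right z ![a, b] 1).symm
    · rw [Fin.snoc_castSucc, Fin.snoc_last]
      exact (Fin.append_right z ![a, b] 0).symm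
    · rw [Fin.snoc_castSucc, Fin.snoc_castSucc]
      exact (Fin.append_left z ![a, b] i).symm
  rw [this]
  rfl

theorem mat_addLine (D : Diagram m n) (x : Fin m → Bool) (y : Fin n → Bool) (a b : Bool) :
    mat (addLine D) (Fin.snoc x a : Fin (m + 1) → Bool) (Fin.snoc y b : Fin (n + 1) → Bool) =
      if a = b then mat D x y else 0 := by
  classical
  rw [mat_apply, mat_apply, if_congr (compat_addLine D x y a b) rfl rfl]
  split_ifs <;> simp_all

theorem mat_bendDown (D : Diagram n (l + 1)) (x : Fin n → Bool) (y : Fin l → Bool) (a : Bool) :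
    mat (bendDown D) (Fin.snoc x a : Fin (n + 1) → Bool) y =
      mat D x (Fin.snoc y a : Fin (l + 1) → Bool) := by
  classical
  rw [mat_apply, mat_apply, if_congr (compat_bendDown D x y a) rfl rfl]

theorem mat_capRight (z : Fin l → Bool) (a b : Bool) (y : Fin l → Bool) :
    mat (capRight l) (Fin.snoc (Fin.snoc z a : Fin (l + 1) → Bool) b : Fin (l + 1 + 1) → Bool) y
      = if a = b then (if z = y then 1 else 0) else 0 := by
  classical
  rw [mat_apply, if_congr (compat_capRight z a b y) rfl rfl]
  split_ifs <;> simp_all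

theorem sum_snoc (f : (Fin (n + 1) → Bool) → ℕ) :
    ∑ z, f z = ∑ b, ∑ z : Fin n → Bool, f (Fin.snoc z b : Fin (n + 1) → Bool) := by
  rw [← Fintype.sum_prod_type']
  exact (Fintype.sum_equiv (Fin.snocEquiv fun _ : Fin (n + 1) => Bool) _ _ fun _ => rfl).symm

theorem exists_snoc (x : Fin (n + 1) → Bool) :
    ∃ (x' : Fin n → Bool) (a : Bool), x = (Fin.snoc x' a : Fin (n + 1) → Bool) :=
  ⟨Fin.init x, x (Fin.last n), (Fin.snoc_init_self x).symm⟩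

/-- `(id_l ⊗ cap) ∘ (D ⊗ id_1)` is `D` with its last top site bent down. -/
theorem mat_addLine_mul_capRight (D : Diagram n (l + 1)) :
    mat (addLine D) * mat (capRight l) = mat (bendDown D) := by
  ext x y
  obtain ⟨x, a, rfl⟩ := exists_snoc x
  rw [Matrix.mul_apply, sum_snoc]
  simp_rw [sum_snoc, mat_addLine, mat_capRight, mat_bendDown]
  simp

/-- Bending down the last top site of `F* ∘ E` if `F` ends in a vertical line: the line is then part
of the bent lower half. -/
theorem mat_bendDown_of_addLine {D : Diagram n (p + 1)} {E : Diagram n (l + 1)} {F : Diagram p l}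
    (h : mat E * mat (addLine F).flip = mat D) :
    mat (bendDown E) * mat F.flip = mat (bendDown D) := by
  ext x y
  obtain ⟨x, a, rfl⟩ := exists_snoc x
  rw [Matrix.mul_apply, mat_bendDown, ← h, Matrix.mul_apply, sum_snoc]
  simp_rw [mat_bendDown, mat_flip, Matrix.transpose_apply, mat_addLine]
  simp

/-- Bending down the last top site of `F* ∘ E` if the upper half comes from bending `F`: its last
arc is cut open and becomes a vertical line of the lower half. -/
theorem mat_bendDown_of_bendDown {D : Diagram n (p + 1)} {E : Diagram n l}
    {F : Diagram p (l + 1)} (h : mat E * mat (bendDown F).flip = mat D) :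
    mat (addLine E) * mat F.flip = mat (bendDown D) := by
  ext x y
  obtain ⟨x, a, rfl⟩ := exists_snoc x
  rw [Matrix.mul_apply, mat_bendDown, ← h, Matrix.mul_apply, sum_snoc]
  simp_rw [mat_addLine, mat_flip, Matrix.transpose_apply, mat_bendDown]
  simp

end Bend

/-! ### Half diagrams and ballot sequences -/

section Half

variable {k : Type*} [CommRing k] {m n p l : ℕ}

/-- All top sites of the diagram are ends of through lines. -/
def Full (D : Diagram n l) : Prop := ∀ j, ∃ i, D.pair (.inr j) = .inl i

theorem throughDegree_eq_card_top (D : Diagram n l) :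
    D.throughDegree = Nat.card {j // ∃ i, D.pair (.inr j) = .inl i} := by
  rw [← throughDegree_flip]
  refine Nat.card_congr (Equiv.subtypeEquivRight fun j => exists_congr fun i => ?_)
  rw [flip_pair_inl]
  constructor <;> intro h <;> rw [← h, D.pair_pair]

theorem throughDegree_lt_iff (D : Diagram n l) : D.throughDegree < l ↔ ¬ Full D := by
  classical
  rw [throughDegree_eq_card_top, Nat.card_eq_fintype_card]
  constructor
  · intro h hD
    have : Fintype.card {j // ∃ i, D.pair (.inr j) = .inl i} = l := by
      rw [Fintype.card_congr (Equiv.subtypeUnivEquiv hD), Fintype.card_fin]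
    omega
  · intro h
    obtain ⟨j, hj⟩ := not_forall.1 h
    simpa using Fintype.card_subtype_lt (p := fun j => ∃ i, D.pair (.inr j) = .inl i) hj

theorem Full.throughDegree {D : Diagram n l} (hD : Full D) : D.throughDegree = l := by
  have h1 := (throughDegree_lt_iff D).not.2 (not_not.2 hD)
  have h2 : D.throughDegree ≤ l := by
    rw [throughDegree_eq_card_top]
    simpa using Finite.card_subtype_le (α := Fin l) fun j => ∃ i, D.pair (.inr j) = .inl i
  omega

theorem addLine_full {D : Diagram n l} : Full (addLine D) ↔ Full D := by
  constructor
  · intro h j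
    obtain ⟨i, hi⟩ := h j.castSucc
    have := addLine_pair D (.inr j)
    rw [Sum.map_inr, hi] at this
    rcases hD : D.pair (.inr j) with i | j'
    · exact ⟨i, rfl⟩
    · rw [hD] at this; simp at this
  · intro h j
    refine Fin.lastCases ?_ (fun j => ?_) j
    · exact ⟨Fin.last n, by rw [← addLine_pair_last, Diagram.pair_pair]⟩
    · obtain ⟨i, hi⟩ := h j
      exact ⟨i.castSucc, by simpa [hi] using addLine_pair D (.inr j)⟩

theorem Full.bendDown {D : Diagram n (l + 1)} (h : Full D) : Full (bendDown D) := by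
  intro j
  obtain ⟨i, hi⟩ := h j.castSucc
  exact ⟨i.castSucc, by rw [← bendEquiv_inr, bendDown_pair, hi, bendEquiv_inl]⟩

theorem Full.of_bendDown {D : Diagram n (l + 1)} (h : Full (TL.bendDown D)) {i : Fin (n + 1)}
    (hi : (TL.bendDown D).pair (.inl (Fin.last n)) = .inl i) : Full D := by
  intro j
  have key : ∀ s : Fin n ⊕ Fin (l + 1), ∀ t, D.pair s = t →
      (TL.bendDown D).pair (bendEquiv n l s) = bendEquiv n l t := by
    rintro s t rfl; rw [bendDown_pair]
  rcases hD : D.pair (.inr j) with i' | j'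
  · exact ⟨i', rfl⟩
  exfalso
  have h1 := key _ _ hD
  have hne : j ≠ j' := fun e => D.pair_ne (.inr j) (by rw [hD, e])
  clear hD
  revert h1 hne
  refine Fin.lastCases ?_ (fun j => ?_) j <;> refine Fin.lastCases ?_ (fun j' => ?_) j' <;>
    intro h1 hne
  · exact hne rfl
  · rw [bendEquiv_last, bendEquiv_inr, hi] at h1; simp at h1
  · rw [bendEquiv_last, bendEquiv_inr] at h1
    rw [← h1, Diagram.pair_pair] at hi; simp at hi
  · rw [bendEquiv_inr, bendEquiv_inr] at h1
    obtain ⟨i, hi⟩ := h j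
    rw [hi] at h1; simp at h1

open Classical in
/-- The sign sequence of the bottom sites of a diagram: `-1` for the right ends of arcs, `+1` for
the left ends of arcs and for the ends of through lines. -/
noncomputable def sgn (D : Diagram n l) (i : Fin n) : ℤˣ :=
  if ∃ j, j < i ∧ D.pair (.inl i) = .inl j then -1 else 1

theorem sgn_congr {D : Diagram n l} {D' : Diagram m p} {i : Fin n} {i' : Fin m}
    (h : (∃ j, j < i ∧ D.pair (.inl i) = .inl j) ↔ ∃ j, j < i' ∧ D'.pair (.inl i') = .inl j) :
    sgn D i = sgn D' i' := by
  classical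
  exact if_congr h rfl rfl

theorem sgn_addLine_castSucc (D : Diagram n l) (i : Fin n) :
    sgn (addLine D) i.castSucc = sgn D i := by
  refine sgn_congr ?_
  have h := addLine_pair D (.inl i)
  rw [Sum.map_inl] at h
  rw [h]
  rcases D.pair (.inl i) with j | j
  · simp only [Sum.map_inl, Sum.inl.injEq]
    constructor
    · rintro ⟨_, hj, rfl⟩; exact ⟨j, hj, rfl⟩
    · rintro ⟨_, hj, rfl⟩; exact ⟨_, hj, rfl⟩
  · simp

theorem sgn_addLine_last (D : Diagram n l) : sgn (addLine D) (Fin.last n) = 1 := by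
  rw [sgn, if_neg]
  rintro ⟨j, -, h⟩
  rw [addLine_pair_last] at h; simp at h

theorem sgn_bendDown_castSucc (D : Diagram n (l + 1)) (i : Fin n) :
    sgn (bendDown D) i.castSucc = sgn D i := by
  refine sgn_congr ?_
  rw [← bendEquiv_inl, bendDown_pair]
  rcases D.pair (.inl i) with j | j
  · simp only [bendEquiv_inl, Sum.inl.injEq]
    constructor
    · rintro ⟨_, hj, rfl⟩; exact ⟨j, hj, rfl⟩
    · rintro ⟨_, hj, rfl⟩; exact ⟨_, hj, rfl⟩
  · refine Fin.lastCases ?_ (fun j => ?_) j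
    · simp only [bendEquiv_last, Sum.inl.injEq]
      constructor
      · rintro ⟨_, hj, rfl⟩; exact absurd hj (Fin.castSucc_lt_last i).not_gt
      · rintro ⟨_, -, hj⟩; simp at hj
    · simp [bendEquiv_inr]

theorem Full.sgn_bendDown_last {D : Diagram n (l + 1)} (h : Full D) :
    sgn (TL.bendDown D) (Fin.last n) = -1 := by
  obtain ⟨i, hi⟩ := h (Fin.last l)
  rw [sgn, if_pos]
  exact ⟨i.castSucc, Fin.castSucc_lt_last i,
    by rw [← bendEquiv_last, bendDown_pair, hi, bendEquiv_inl]⟩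

/-- If bending creates a full diagram from one that is not full, then it straightens a cup, and the
last bottom site becomes the end of a through line. -/
theorem sgn_bendDown_last_of_not_full {D : Diagram n (l + 1)} (h : ¬ Full D)
    (h' : Full (bendDown D)) : sgn (bendDown D) (Fin.last n) = 1 := by
  rw [sgn, if_neg]
  rintro ⟨j, -, hj⟩
  exact h (h'.of_bendDown hj)

/-- A full diagram whose last bottom site is the end of a through line ends in a vertical line. -/
theorem Full.exists_addLine {D : Diagram (n + 1) (l + 1)} (hD : Full D) {j : Fin (l + 1)}
    (hj : D.pair (.inl (Fin.last n)) = .inr j) : ∃ D' : Diagram n l, D = addLine D' := by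
  -- by planarity, the last bottom site is joined to the last top site
  have hlast : j = Fin.last l := by
    by_contra hne
    obtain ⟨i, hi⟩ := hD (Fin.last l)
    have h1 := D.planar (.inl i) (.inl (Fin.last n))
    have hi' : D.pair (.inl i) = .inr (Fin.last l) := by rw [← hi, D.pair_pair]
    rw [hi', hj] at h1
    have h2 : i ≠ Fin.last n := fun e => hne (by
      rw [e, hj] at hi'; exact Sum.inr_injective hi')
    have h3 := Fin.val_lt_last h2
    have h4 := Fin.val_lt_last hne
    simp only [pos, Fin.val_last] at h1
    omega
  subst hlast
  have hj' : D.pair (.inr (Fin.last l)) = .inl (Fin.last n) := by rw [← hj, D.pair_pair]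
  let ι : Fin n ⊕ Fin l → Fin (n + 1) ⊕ Fin (l + 1) := Sum.map Fin.castSucc Fin.castSucc
  have hι : ∀ s, ι s ≠ .inl (Fin.last n) ∧ ι s ≠ .inr (Fin.last l) := by
    rintro (i | i) <;> simp [ι, Fin.castSucc_ne_last]
  have hcl : ∀ t, t ≠ .inl (Fin.last n) → t ≠ .inr (Fin.last l) → ∃ s, t = ι s := by
    rintro (i | i)
    · refine Fin.lastCases (fun h => absurd rfl h) (fun i _ _ => ⟨.inl i, rfl⟩) i
    · refine Fin.lastCases (fun _ h => absurd rfl h) (fun i _ _ => ⟨.inr i, rfl⟩) i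
  obtain ⟨D', hD'⟩ := exists_diagram_of_nonCrossing (q := pos) (f := D.pair) D.pair_pair D.planar ι
    (Sum.map_injective.2 ⟨Fin.castSucc_injective _, Fin.castSucc_injective _⟩)
    (by
      rintro (⟨i, hi⟩ | ⟨i, hi⟩) (⟨j, hj⟩ | ⟨j, hj⟩) <;>
        simp only [ι, Sum.map_inl, Sum.map_inr, pos, Fin.castSucc_mk] <;> omega)
    (fun s => hcl _
      (fun h => (hι s).2 (by rw [← D.pair_pair (ι s), h, hj]))
      (fun h => (hι s).1 (by rw [← D.pair_pair (ι s), h, hj'])))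
    (fun s => D.pair_ne _)
  refine ⟨D', ?_⟩
  ext1; ext1 t
  by_cases h1 : t = .inl (Fin.last n)
  · rw [h1, addLine_pair_last, hj]
  by_cases h2 : t = .inr (Fin.last l)
  · rw [h2, hj', ← addLine_pair_last D', Diagram.pair_pair]
  obtain ⟨s, rfl⟩ := hcl t h1 h2
  rw [← hD']
  exact (addLine_pair D' s).symm

/-- Sequences of signs with nonnegative partial sums and total sum `l`, in the recursive form that
matches the recursion of the down morphisms. -/
def IsBallot : {n : ℕ} → (Fin n → ℤˣ) → ℕ → Prop
  | 0, _, l => l = 0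
  | n + 1, s, l =>
    (s (Fin.last n) = 1 ∧ ∃ l', l = l' + 1 ∧ IsBallot (fun i : Fin n => s i.castSucc) l') ∨
      (s (Fin.last n) = -1 ∧ IsBallot (fun i : Fin n => s i.castSucc) (l + 1))

theorem downSeq_succ_pos (δ : k) (G : (n : ℕ) → Hom k n n) {s : Fin (n + 1) → ℤˣ}
    (h : s (Fin.last n) = 1) (l : ℕ) :
    downSeq δ G s (l + 1) = epsPlus δ G (downSeq δ G (fun i : Fin n => s i.castSucc) l) := by
  simp [downSeq, h]

theorem downSeq_succ_neg (δ : k) (G : (n : ℕ) → Hom k n n) {s : Fin (n + 1) → ℤˣ}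
    (h : s (Fin.last n) = -1) (l : ℕ) :
    downSeq δ G s l = epsMinus δ G (downSeq δ G (fun i : Fin n => s i.castSucc) (l + 1)) := by
  simp [downSeq, h]

theorem tensorHom_id (D : Diagram m n) :
    tensorHom (ofDiagram D) (idHom k 1) = ofDiagram (addLine D) :=
  tensorHom_ofDiagram _ _

theorem comp_capRight (δ : k) (D : Diagram n (l + 1)) :
    comp δ (tensorHom (idHom k l) (ofDiagram Diagram.cap) : Hom k (l + 1 + 1) l)
      (tensorHom (ofDiagram D) (idHom k 1)) = ofDiagram (bendDown D) := by
  rw [tensorHom_id, idHom, tensorHom_ofDiagram]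
  exact comp_ofDiagram_of_mat_eq δ (mat_addLine_mul_capRight D)

theorem epsPlus_id (δ : k) (D : Diagram m n) :
    epsPlus δ (idHom k) (ofDiagram D) = ofDiagram (addLine D) := by
  rw [epsPlus, id_comp, tensorHom_id]

theorem epsMinus_id (δ : k) (D : Diagram m (n + 1)) :
    epsMinus δ (idHom k) (ofDiagram D) = ofDiagram (bendDown D) := by
  rw [epsMinus, id_comp, comp_capRight]

theorem Full.isBallot_and_downSeq (δ : k) {D : Diagram n l} (hD : Full D) :
    IsBallot (sgn D) l ∧ downSeq δ (idHom k) (sgn D) l = ofDiagram D := by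
  induction n generalizing l with
  | zero =>
    rcases l with _ | l
    · refine ⟨rfl, ?_⟩
      have : D = Diagram.idn 0 := by ext1; ext1 s; rcases s with s | s <;> exact s.elim0
      rw [this]; rfl
    · exact (hD 0).choose.elim0
  | succ n ih =>
    rcases h : D.pair (.inl (Fin.last n)) with i | j
    · obtain ⟨D, rfl⟩ := bendDown_surjective D
      have hD' := hD.of_bendDown h
      obtain ⟨h1, h2⟩ := ih hD'
      have e : (fun i : Fin n => sgn (TL.bendDown D) i.castSucc) = sgn D :=
        funext (sgn_bendDown_castSucc D)
      refine ⟨.inr ⟨hD'.sgn_bendDown_last, ?_⟩, ?_⟩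
      · rwa [e]
      · rw [downSeq_succ_neg δ _ hD'.sgn_bendDown_last, e, h2, epsMinus_id]
    · rcases l with _ | l
      · exact j.elim0
      obtain ⟨D, rfl⟩ := hD.exists_addLine h
      obtain ⟨h1, h2⟩ := ih (addLine_full.1 hD)
      have e : (fun i : Fin n => sgn (addLine D) i.castSucc) = sgn D :=
        funext (sgn_addLine_castSucc D)
      refine ⟨.inl ⟨sgn_addLine_last D, l, rfl, ?_⟩, ?_⟩
      · rwa [e]
      · rw [downSeq_succ_pos δ _ (sgn_addLine_last D), e, h2, epsPlus_id]

theorem IsBallot.exists_full {s : Fin n → ℤˣ} (hs : IsBallot s l) :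
    ∃ D : Diagram n l, Full D ∧ sgn D = s := by
  induction n generalizing l with
  | zero =>
    cases hs
    exact ⟨Diagram.idn 0, fun j => j.elim0, funext fun j => j.elim0⟩
  | succ n ih =>
    rcases hs with ⟨h, l, rfl, hs⟩ | ⟨h, hs⟩ <;> obtain ⟨D, hD, e⟩ := ih hs
    · refine ⟨addLine D, addLine_full.2 hD, funext fun i => ?_⟩
      refine Fin.lastCases ?_ (fun i => ?_) i
      · rw [sgn_addLine_last, h]
      · rw [sgn_addLine_castSucc, e]
    · refine ⟨bendDown D, hD.bendDown, funext fun i => ?_⟩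
      refine Fin.lastCases ?_ (fun i => ?_) i
      · rw [hD.sgn_bendDown_last, h]
      · rw [sgn_bendDown_castSucc, e]

theorem Full.eq_of_sgn_eq {D D' : Diagram n l} (hD : Full D) (hD' : Full D')
    (h : sgn D = sgn D') : D = D' := by
  have h1 := (hD.isBallot_and_downSeq (0 : ℤ)).2
  rw [h, (hD'.isBallot_and_downSeq (0 : ℤ)).2] at h1
  exact (Finsupp.single_left_injective one_ne_zero h1).symm

end Half

/-! ### Factorization of diagrams through half diagrams -/

section Factor

variable {a b l : ℕ}

/-- Every diagram is a lower half diagram followed by an upper one. The bottom sites are moved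
to the top one by one, which leaves a diagram without bottom sites, and are bent back. -/
theorem exists_factorization (D : Diagram a b) :
    ∃ (l : ℕ) (E : Diagram a l) (F : Diagram b l), Full E ∧ Full F ∧
      mat E * mat F.flip = mat D := by
  induction a generalizing b with
  | zero =>
    refine ⟨0, Diagram.idn 0, D.flip, fun j => j.elim0, fun j => j.elim0, ?_⟩
    rw [mat_idn, flip_flip, Matrix.one_mul]
  | succ a ih =>
    obtain ⟨D, rfl⟩ := bendDown_surjective D
    obtain ⟨l, E, F, hE, hF, h⟩ := ih D
    rcases hlast : F.pair (.inl (Fin.last b)) with i | j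
    · obtain ⟨F, rfl⟩ := bendDown_surjective F
      exact ⟨l + 1, addLine E, F, addLine_full.2 hE, hF.of_bendDown hlast,
        mat_bendDown_of_bendDown h⟩
    · rcases l with _ | l
      · exact j.elim0
      obtain ⟨F, rfl⟩ := hF.exists_addLine hlast
      exact ⟨l, bendDown E, F, hE.bendDown, addLine_full.1 hF, mat_bendDown_of_addLine h⟩

variable {E : Diagram a l} {F : Diagram b l} {D : Diagram a b}

theorem Full.flip_pair {F : Diagram b l} (hF : Full F) (j : Fin l) :
    ∃ i, F.flip.pair (.inl j) = .inr i := by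
  obtain ⟨i, hi⟩ := hF j
  exact ⟨i, flip_pair_inl.2 (by rw [← hi, F.pair_pair])⟩

/-- A composite of full half diagrams has no closed loops. -/
theorem loops_of_full (hE : Full E) : Diagram.loops F.flip E = 0 := by
  refine Finite.card_eq_zero_iff.2 ⟨fun ⟨C, hC⟩ => ?_⟩
  induction C using SimpleGraph.ConnectedComponent.ind with | _ v => ?_
  obtain ⟨j, rfl⟩ := hC v rfl
  obtain ⟨i, hi⟩ := hE j
  have h := reachable_lower F.flip E (.inr j)
  rw [hi] at h
  obtain ⟨j', hj'⟩ := hC (.inl i) (SimpleGraph.ConnectedComponent.sound h.symm)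
  simp at hj'

theorem sgn_of_isConcat (hF : Full F) (h : Diagram.IsConcat F.flip E D) : sgn D = sgn E := by
  ext1 i
  refine sgn_congr (exists_congr fun j => and_congr_right fun _ => ?_)
  constructor
  · intro hD
    rcases hE : E.pair (.inl i) with j' | j'
    · rw [concat_pair_of_arc h hE] at hD; rw [Sum.inl_injective hD]
    · obtain ⟨i', hi'⟩ := hF.flip_pair j'
      rw [concat_pair_of_through h hE hi'] at hD; simp at hD
  · exact concat_pair_of_arc h

theorem throughDegree_of_isConcat (hE : Full E) (hF : Full F)
    (h : Diagram.IsConcat F.flip E D) : D.throughDegree = l := by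
  rw [← hE.throughDegree]
  refine Nat.card_congr (Equiv.subtypeEquivRight fun i => ?_)
  constructor
  · rintro ⟨j, hj⟩
    rcases hE : E.pair (.inl i) with j' | j'
    · rw [concat_pair_of_arc h hE] at hj; simp at hj
    · exact ⟨j', rfl⟩
  · rintro ⟨j, hj⟩
    obtain ⟨i', hi'⟩ := hF.flip_pair j
    exact ⟨i', concat_pair_of_through h hj hi'⟩

end Factor

/-! ### Standard tableaux and ballot sequences -/

section Count

variable {n : ℕ}

/-- The number of signs `e` among the first `j` entries of `s`. -/
def count (s : Fin n → ℤˣ) (e : ℤˣ) (j : ℕ) : ℕ :=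
  (Finset.univ.filter fun i : Fin n => (i : ℕ) < j ∧ s i = e).card

theorem count_zero (s : Fin n → ℤˣ) (e : ℤˣ) : count s e 0 = 0 := by
  simp [count]

theorem count_mono (s : Fin n → ℤˣ) (e : ℤˣ) : Monotone (count s e) := fun j j' h =>
  Finset.card_le_card fun i hi => by
    simp only [Finset.mem_filter_univ] at hi ⊢
    exact ⟨hi.1.trans_le h, hi.2⟩

theorem count_succ (s : Fin n → ℤˣ) (e : ℤˣ) (i : Fin n) :
    count s e (i + 1) = count s e i + if s i = e then 1 else 0 := by
  have h : (Finset.univ.filter fun j : Fin n => (j : ℕ) < i + 1 ∧ s j = e) =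
      (Finset.univ.filter fun j : Fin n => (j : ℕ) < i ∧ s j = e) ∪
        if s i = e then {i} else ∅ := by
    ext j
    rw [Finset.mem_union, Finset.mem_filter_univ, Finset.mem_filter_univ,
      Nat.lt_succ_iff_lt_or_eq, ← Fin.ext_iff]
    split_ifs with hi
    · rw [Finset.mem_singleton]
      constructor
      · rintro ⟨h | h, h'⟩
        exacts [.inl ⟨h, h'⟩, .inr h]
      · rintro (h | rfl)
        exacts [⟨.inl h.1, h.2⟩, ⟨.inr rfl, hi⟩]
    · simp only [Finset.notMem_empty, or_false]
      constructor
      · rintro ⟨h | rfl, h'⟩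
        exacts [⟨h, h'⟩, absurd h' hi]
      · exact fun h => ⟨.inl h.1, h.2⟩
  rw [count, h, Finset.card_union_of_disjoint]
  · split_ifs <;> rfl
  · split_ifs <;> simp

theorem count_init (s : Fin (n + 1) → ℤˣ) (e : ℤˣ) {j : ℕ} (hj : j ≤ n) :
    count (fun i : Fin n => s i.castSucc) e j = count s e j := by
  refine Finset.card_bij (fun i _ => i.castSucc) ?_ ?_ ?_
  · intro i hi
    simpa using hi
  · intro i _ i' _ h
    exact Fin.castSucc_injective _ h
  · intro i hi
    rw [Finset.mem_filter_univ] at hi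
    exact ⟨⟨i, by omega⟩, by simpa using hi, rfl⟩

theorem count_last (s : Fin (n + 1) → ℤˣ) (e : ℤˣ) :
    count s e (n + 1) =
      count (fun i : Fin n => s i.castSucc) e n + if s (Fin.last n) = e then 1 else 0 := by
  rw [count_init s e le_rfl]
  exact count_succ s e (Fin.last n)

theorem units_int_eq_neg_one {e : ℤˣ} (h : e ≠ 1) : e = -1 :=
  (Int.units_eq_one_or e).resolve_left h

/-- The recursive form of the ballot condition agrees with the one in terms of partial sums. -/
theorem isBallot_iff {s : Fin n → ℤˣ} {l : ℕ} :
    IsBallot s l ↔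
      (∀ j ≤ n, count s (-1) j ≤ count s 1 j) ∧ count s 1 n = count s (-1) n + l := by
  induction n generalizing l with
  | zero =>
    simp only [IsBallot, Nat.le_zero, forall_eq, count_zero]
    simp [eq_comm]
  | succ n ih =>
    have hj : (∀ j ≤ n + 1, count s (-1) j ≤ count s 1 j) ↔
        (∀ j ≤ n, count (fun i : Fin n => s i.castSucc) (-1) j ≤
          count (fun i : Fin n => s i.castSucc) 1 j) ∧
        count s (-1) (n + 1) ≤ count s 1 (n + 1) := by
      constructor
      · intro h
        refine ⟨fun j hj => ?_, h _ le_rfl⟩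
        rw [count_init s _ hj, count_init s _ hj]
        exact h j (by omega)
      · rintro ⟨h1, h2⟩ j hj
        rcases Nat.le_succ_iff.1 hj with hj | rfl
        · have := h1 j hj
          rwa [count_init s _ hj, count_init s _ hj] at this
        · exact h2
    have ne : (1 : ℤˣ) ≠ -1 := by decide
    rw [hj, count_last, count_last, IsBallot]
    by_cases h : s (Fin.last n) = 1
    · simp only [h, ih, true_and, ne, false_and, or_false, if_true, if_false]
      constructor
      · rintro ⟨l, rfl, h1, h2⟩
        refine ⟨⟨h1, ?_⟩, ?_⟩ <;> omega
      · rintro ⟨⟨h1, h2⟩, h3⟩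
        have := h1 n le_rfl
        exact ⟨l - 1, by omega, h1, by omega⟩
    · have h := units_int_eq_neg_one h
      simp only [h, ih, true_and, ne.symm, false_and, false_or, if_true, if_false]
      constructor
      · rintro ⟨h1, h2⟩
        refine ⟨⟨h1, ?_⟩, ?_⟩ <;> omega
      · rintro ⟨⟨h1, h2⟩, h3⟩
        exact ⟨h1, by omega⟩

theorem count_add_count (s : Fin n → ℤˣ) {j : ℕ} (hj : j ≤ n) :
    count s 1 j + count s (-1) j = j := by
  induction j with
  | zero => simp [count_zero]
  | succ j ih =>
    have ne : (1 : ℤˣ) ≠ -1 := by decide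
    have h1 := count_succ s 1 ⟨j, hj⟩
    have h2 := count_succ s (-1) ⟨j, hj⟩
    have := ih (by omega)
    by_cases h : s ⟨j, hj⟩ = 1
    · simp only [h, ne, if_true, if_false] at h1 h2; omega
    · have h := units_int_eq_neg_one h
      simp only [h, ne.symm, if_true, if_false] at h1 h2; omega

/-- The `c`-th occurrence of a sign. -/
theorem exists_count_eq (s : Fin n → ℤˣ) (e : ℤˣ) {c j : ℕ} (hj : j ≤ n) (hc : c < count s e j) :
    ∃ i : Fin n, s i = e ∧ count s e i = c := by
  induction j with
  | zero => rw [count_zero] at hc; omega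
  | succ j ih =>
    by_cases h : c < count s e j
    · exact ih (by omega) h
    · have := count_succ s e ⟨j, hj⟩
      simp only at this
      by_cases h' : s ⟨j, hj⟩ = e
      · rw [if_pos h'] at this
        exact ⟨⟨j, hj⟩, h', by simp only; omega⟩
      · rw [if_neg h'] at this
        omega

end Count

section Tableau

variable {n l l₁ l₂ : ℕ} {h : l₂ ≤ l₁}

theorem mem_twoRow {c : ℕ × ℕ} :
    c ∈ (twoRow l₁ l₂ h).cells ↔ (c.1 = 0 ∧ c.2 < l₁) ∨ (c.1 = 1 ∧ c.2 < l₂) := by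
  obtain ⟨r, c⟩ := c
  rw [YoungDiagram.mem_cells, twoRow, YoungDiagram.mem_ofRowLens]
  rcases r with _ | _ | r <;> simp

theorem rowLen_twoRow_zero : (twoRow l₁ l₂ h).rowLen 0 = l₁ := by
  refine eq_of_forall_lt_iff fun c => ?_
  rw [← YoungDiagram.mem_iff_lt_rowLen, ← YoungDiagram.mem_cells, mem_twoRow]
  simp

theorem rowLen_twoRow_one : (twoRow l₁ l₂ h).rowLen 1 = l₂ := by
  refine eq_of_forall_lt_iff fun c => ?_
  rw [← YoungDiagram.mem_iff_lt_rowLen, ← YoungDiagram.mem_cells, mem_twoRow]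
  simp

/-- The row containing the number `i + 1`. -/
def rowOf (t : StdTableau (twoRow l₁ l₂ h) n) (i : Fin n) : ℕ := (t.entry.symm i).1.1

theorem rowOf_eq (t : StdTableau (twoRow l₁ l₂ h) n) (i : Fin n) : rowOf t i = 0 ∨ rowOf t i = 1 :=
  (mem_twoRow.1 (t.entry.symm i).2).imp And.left And.left

theorem signs_eq_one (t : StdTableau (twoRow l₁ l₂ h) n) (i : Fin n) :
    t.signs i = 1 ↔ rowOf t i = 0 := by
  rw [StdTableau.signs, rowOf]
  split_ifs with hi <;> simp [hi]

theorem signs_eq_neg_one (t : StdTableau (twoRow l₁ l₂ h) n) (i : Fin n) :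
    t.signs i = -1 ↔ rowOf t i = 1 := by
  have := rowOf_eq t i
  rw [StdTableau.signs]
  split_ifs with hi <;> rw [rowOf] at this ⊢
  · simp [hi]
  · simp only [true_iff]; omega

theorem rowLen_sub (t : StdTableau (twoRow l₁ l₂ h) n) (j r : ℕ) :
    (t.sub j).rowLen r =
      (Finset.univ.filter fun i : Fin n => (i : ℕ) < j ∧ rowOf t i = r).card := by
  rw [YoungDiagram.rowLen_eq_card]
  symm
  refine Finset.card_bij (fun i _ => (t.entry.symm i).1) ?_ ?_ ?_
  · intro i hi
    rw [Finset.mem_filter_univ] at hi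
    rw [YoungDiagram.mem_row_iff]
    refine ⟨?_, hi.2⟩
    rw [← YoungDiagram.mem_cells, StdTableau.sub, Finset.mem_filter]
    exact ⟨(t.entry.symm i).2, (t.entry.symm i).2, by simpa using hi.1⟩
  · intro i _ i' _ hi
    exact t.entry.symm.injective (Subtype.ext hi)
  · intro c hc
    rw [YoungDiagram.mem_row_iff, ← YoungDiagram.mem_cells, StdTableau.sub, Finset.mem_filter] at hc
    obtain ⟨⟨hc, _, hj⟩, hr⟩ := hc
    refine ⟨t.entry ⟨c, hc⟩, ?_, by simp⟩
    rw [Finset.mem_filter_univ]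
    exact ⟨hj, by simpa [rowOf] using hr⟩

theorem rowLen_sub_zero (t : StdTableau (twoRow l₁ l₂ h) n) (j : ℕ) :
    (t.sub j).rowLen 0 = count t.signs 1 j := by
  rw [rowLen_sub, count]
  simp only [signs_eq_one]

theorem rowLen_sub_one (t : StdTableau (twoRow l₁ l₂ h) n) (j : ℕ) :
    (t.sub j).rowLen 1 = count t.signs (-1) j := by
  rw [rowLen_sub, count]
  simp only [signs_eq_neg_one]

theorem rowLen_sub_add_two (t : StdTableau (twoRow l₁ l₂ h) n) (j r : ℕ) :
    (t.sub j).rowLen (r + 2) = 0 := by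
  rw [rowLen_sub, Finset.card_eq_zero, Finset.filter_eq_empty_iff]
  intro i _ hi
  have := rowOf_eq t i
  omega

theorem sub_self (t : StdTableau (twoRow l₁ l₂ h) n) : t.sub n = twoRow l₁ l₂ h := by
  ext c
  rw [StdTableau.sub, Finset.mem_filter]
  exact ⟨fun h => h.1, fun h => ⟨h, h, (t.entry _).2⟩⟩

theorem count_signs_one (t : StdTableau (twoRow l₁ l₂ h) n) : count t.signs 1 n = l₁ := by
  rw [← rowLen_sub_zero, sub_self, rowLen_twoRow_zero]

theorem count_signs_neg_one (t : StdTableau (twoRow l₁ l₂ h) n) : count t.signs (-1) n = l₂ := by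
  rw [← rowLen_sub_one, sub_self, rowLen_twoRow_one]

theorem isBallot_signs (t : Tab n l) : IsBallot t.signs l := by
  rw [isBallot_iff]
  refine ⟨fun j _ => ?_, ?_⟩
  · rw [← rowLen_sub_one, ← rowLen_sub_zero]
    exact (t.sub j).rowLen_anti 0 1 zero_le_one
  · rw [count_signs_one, count_signs_neg_one, add_comm]

/-- A number is placed in its row to the right of the smaller numbers of that row. -/
theorem col_eq_count (t : StdTableau (twoRow l₁ l₂ h) n) (i : Fin n) :
    (t.entry.symm i).1.2 = count t.signs (t.signs i) i := by
  have hs : ∀ j, t.signs j = t.signs i ↔ rowOf t j = rowOf t i := by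
    intro j
    rcases rowOf_eq t i with hi | hi
    · rw [(signs_eq_one t i).2 hi, signs_eq_one, hi]
    · rw [(signs_eq_neg_one t i).2 hi, signs_eq_neg_one, hi]
  rw [count, ← Finset.card_range (t.entry.symm i).1.2]
  symm
  refine Finset.card_bij (fun j _ => (t.entry.symm j).1.2) ?_ ?_ ?_
  · intro j hj
    rw [Finset.mem_filter_univ, hs] at hj
    rw [Finset.mem_range]
    by_contra hle
    have := t.entry_mono (t.entry.symm i) (t.entry.symm j) hj.2.ge (not_lt.1 hle)
    rw [Equiv.apply_symm_apply, Equiv.apply_symm_apply] at this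
    exact absurd hj.1 (not_lt.2 this)
  · intro j hj j' hj' hjj
    rw [Finset.mem_filter_univ, hs] at hj hj'
    exact t.entry.symm.injective (Subtype.ext (Prod.ext (hj.2.trans hj'.2.symm) hjj))
  · intro c hc
    rw [Finset.mem_range] at hc
    have hmem : (rowOf t i, c) ∈ (twoRow l₁ l₂ h).cells :=
      (twoRow l₁ l₂ h).up_left_mem le_rfl hc.le (t.entry.symm i).2
    have hlt := t.row_strict ⟨_, hmem⟩ (t.entry.symm i) rfl hc
    rw [Equiv.apply_symm_apply] at hlt
    refine ⟨t.entry ⟨_, hmem⟩, ?_, by simp⟩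
    rw [Finset.mem_filter_univ, hs]
    exact ⟨hlt, by simp [rowOf]⟩

theorem signs_injective :
    Function.Injective (StdTableau.signs : StdTableau (twoRow l₁ l₂ h) n → _) := by
  intro t t' hs
  have key : t.entry.symm = t'.entry.symm := by
    ext1 i
    refine Subtype.ext (Prod.ext ?_ ?_)
    · have h1 := signs_eq_one t i
      have h2 := signs_eq_one t' i
      rw [hs, h2] at h1
      have h3 := rowOf_eq t i
      have h4 := rowOf_eq t' i
      change rowOf t i = rowOf t' i
      omega
    · rw [col_eq_count, col_eq_count, hs]
  apply StdTableau.ext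
  rw [← Equiv.symm_symm t.entry, key, Equiv.symm_symm]

/-- In a tableau with sign sequence `s`, the number `i + 1` has to be placed in the row given by
its sign, after the smaller numbers with the same sign; the ballot condition makes the columns
increase. -/
theorem exists_signs_eq {s : Fin n → ℤˣ} (hs : IsBallot s l) : ∃ t : Tab n l, t.signs = s := by
  obtain ⟨hb, hl⟩ := isBallot_iff.1 hs
  have hn := count_add_count s le_rfl
  have h2 : count s (-1) n = (n - l) / 2 := by omega
  have h1 : count s 1 n = l + (n - l) / 2 := by omega
  have ne : (-1 : ℤˣ) ≠ 1 := by decide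
  have hlt : ∀ (e : ℤˣ) (i : Fin n), s i = e → count s e i < count s e n := by
    intro e i hi
    have h1 := count_succ s e i
    rw [if_pos hi] at h1
    have h2 := count_mono s e (show (i : ℕ) + 1 ≤ n from i.2)
    omega
  let f : Fin n → (twoRow (l + (n - l) / 2) ((n - l) / 2) (Nat.le_add_left _ _)).cells := fun i =>
    ⟨(if s i = 1 then 0 else 1, count s (s i) i), by
      rw [mem_twoRow]
      by_cases hi : s i = 1
      · left
        simp only [hi, if_true, true_and, ← h1]
        exact hlt 1 i hi
      · right
        have hi := units_int_eq_neg_one hi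
        simp only [hi, ne, if_false, true_and, ← h2]
        exact hlt (-1) i hi⟩
  have hrow : ∀ i i', (f i).1.1 = (f i').1.1 → s i = s i' := by
    intro i i' hii
    rcases Int.units_eq_one_or (s i) with hi | hi <;>
      rcases Int.units_eq_one_or (s i') with hi' | hi' <;> simp [f, hi, hi'] at hii ⊢
  have hcol : ∀ i i', (f i).1.1 = (f i').1.1 → (f i).1.2 < (f i').1.2 → i < i' := by
    intro i i' hii hlt
    have := hrow i i' hii
    simp only [f, this] at hlt
    by_contra hle
    have := count_mono s (s i') (not_lt.1 hle : (i' : ℕ) ≤ i)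
    omega
  have hf : Function.Bijective f := by
    constructor
    · intro i i' hii
      have hs := hrow i i' (by rw [hii])
      have hc : count s (s i) i = count s (s i') i' := congrArg (fun c => c.1.2) hii
      by_contra hne
      rcases lt_or_gt_of_ne hne with hlt | hlt
      · have h1 := count_succ s (s i) i
        have h2 := count_mono s (s i) (show (i : ℕ) + 1 ≤ i' from hlt)
        rw [if_pos rfl] at h1
        rw [← hs] at hc
        omega
      · have h1 := count_succ s (s i') i'
        have h2 := count_mono s (s i') (show (i' : ℕ) + 1 ≤ i from hlt)
        rw [if_pos rfl] at h1
        rw [hs] at hc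
        omega
    · rintro ⟨⟨r, c⟩, hrc⟩
      rcases mem_twoRow.1 hrc with ⟨hr, hc⟩ | ⟨hr, hc⟩ <;> simp only at hr hc <;> subst hr
      · obtain ⟨i, hi, hi'⟩ := exists_count_eq s 1 le_rfl (h1.symm ▸ hc)
        exact ⟨i, Subtype.ext (by simp [f, hi, hi'])⟩
      · obtain ⟨i, hi, hi'⟩ := exists_count_eq s (-1) le_rfl (h2.symm ▸ hc)
        exact ⟨i, Subtype.ext (by simp [f, hi, hi', ne])⟩
  let g := Equiv.ofBijective f hf
  refine ⟨⟨g.symm, ?_, ?_⟩, ?_⟩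
  · intro c d
    obtain ⟨i, rfl⟩ := g.surjective c
    obtain ⟨i', rfl⟩ := g.surjective d
    rw [Equiv.symm_apply_apply, Equiv.symm_apply_apply]
    exact hcol i i'
  · intro c d
    obtain ⟨i, rfl⟩ := g.surjective c
    obtain ⟨i', rfl⟩ := g.surjective d
    rw [Equiv.symm_apply_apply, Equiv.symm_apply_apply]
    intro hc hr
    change count s (s i) i = count s (s i') i' at hc
    have hi : s i = 1 := by
      by_contra hi
      have : (f i).1.1 = 1 := if_neg hi
      have h' : (f i').1.1 ≤ 1 := by simp only [f]; split_ifs <;> omega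
      change (f i).1.1 < (f i').1.1 at hr
      omega
    have hi' : s i' = -1 := by
      refine units_int_eq_neg_one fun hi' => ?_
      have : (f i').1.1 = 0 := if_pos hi'
      change (f i).1.1 < (f i').1.1 at hr
      omega
    rw [hi, hi'] at hc
    by_contra hle
    -- the ballot condition just after position `i'` forces the matching `+1` to come first
    have h1 := hb (i' + 1) i'.2
    have h2 := count_succ s (-1) i'
    rw [if_pos hi'] at h2
    have h3 := count_succ s 1 i'
    rw [hi', if_neg ne] at h3
    have h4 := count_mono s 1 (not_lt.1 hle : (i' : ℕ) ≤ i)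
    omega
  · ext1 i
    simp only [StdTableau.signs, Equiv.symm_symm]
    change (if (f i).1.1 = 0 then (1 : ℤˣ) else -1) = s i
    by_cases hi : s i = 1
    · simp [f, hi]
    · have hi := units_int_eq_neg_one hi
      simp [f, hi, ne]

end Tableau

/-! ### The reverse lexicographic order -/

section Order

variable {n l : ℕ}

/-- The reverse lexicographic order on sign sequences with the same sum: at the last position where
they differ, `u` has `+1` and `t` has `-1`. -/
def SignLT (u t : Fin n → ℤˣ) : Prop := ∃ i, u i = 1 ∧ t i = -1 ∧ ∀ j, i < j → u j = t j

theorem SignLT.of_init {u t : Fin (n + 1) → ℤˣ}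
    (h : SignLT (fun i : Fin n => u i.castSucc) (fun i : Fin n => t i.castSucc))
    (hl : u (Fin.last n) = t (Fin.last n)) : SignLT u t := by
  obtain ⟨i, h1, h2, h3⟩ := h
  refine ⟨i.castSucc, h1, h2, fun j => ?_⟩
  refine Fin.lastCases (fun _ => hl) (fun j hj => h3 j hj) j

theorem SignLT.of_last {u t : Fin (n + 1) → ℤˣ} (hu : u (Fin.last n) = 1)
    (ht : t (Fin.last n) = -1) : SignLT u t :=
  ⟨Fin.last n, hu, ht, fun j hj => absurd hj (Fin.le_last j).not_gt⟩

theorem SignLT.ne {u t : Fin n → ℤˣ} (h : SignLT u t) : u ≠ t := by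
  rintro rfl
  obtain ⟨i, h1, h2, -⟩ := h
  rw [h1] at h2
  exact absurd h2 (by decide)

/-- A linearization of the reverse lexicographic order: the sign sequence read as a binary
number. -/
def binary (s : Fin n → ℤˣ) : ℕ := ∑ i, if s i = -1 then 2 ^ (i : ℕ) else 0

theorem binary_succ (s : Fin (n + 1) → ℤˣ) :
    binary s = binary (fun i : Fin n => s i.castSucc) +
      if s (Fin.last n) = -1 then 2 ^ n else 0 := by
  rw [binary, Fin.sum_univ_castSucc]
  rfl

theorem binary_lt (s : Fin n → ℤˣ) : binary s < 2 ^ n := by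
  induction n with
  | zero => simp [binary]
  | succ n ih =>
    have := ih fun i : Fin n => s i.castSucc
    rw [binary_succ, pow_succ]
    split_ifs <;> omega

theorem SignLT.binary_lt {u t : Fin n → ℤˣ} (h : SignLT u t) : binary u < binary t := by
  induction n with
  | zero => exact h.choose.elim0
  | succ n ih =>
    obtain ⟨i, h1, h2, h3⟩ := h
    have ne : (1 : ℤˣ) ≠ -1 := by decide
    rw [binary_succ, binary_succ]
    revert h1 h2 h3
    refine Fin.lastCases (fun h1 h2 _ => ?_) (fun i h1 h2 h3 => ?_) i
    · rw [h1, h2, if_neg ne, if_pos rfl]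
      have := TL.binary_lt fun i : Fin n => u i.castSucc
      omega
    · rw [h3 _ (Fin.castSucc_lt_last i)]
      have := ih (u := fun i : Fin n => u i.castSucc) (t := fun i : Fin n => t i.castSucc)
        ⟨i, h1, h2, fun j hj => h3 _ hj⟩
      omega

theorem count_eq_of_tail {u t : Fin n → ℤˣ} {e : ℤˣ} {m j : ℕ}
    (h : ∀ i : Fin n, m ≤ i → u i = t i) (hn : count u e n = count t e n) (hj : m ≤ j) :
    count u e j = count t e j := by
  have key : ∀ s : Fin n → ℤˣ, count s e n =
      count s e j + (Finset.univ.filter fun i : Fin n => j ≤ (i : ℕ) ∧ s i = e).card := by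
    intro s
    rw [count, count, ← Finset.card_union_of_disjoint]
    · congr 1
      ext i
      simp only [Finset.mem_union, Finset.mem_filter_univ]
      have := lt_or_ge (i : ℕ) j
      have := i.2
      tauto
    · rw [Finset.disjoint_filter]
      omega
  have ht : (Finset.univ.filter fun i : Fin n => j ≤ (i : ℕ) ∧ u i = e) =
      Finset.univ.filter fun i : Fin n => j ≤ (i : ℕ) ∧ t i = e :=
    Finset.filter_congr fun i _ => and_congr_right fun hi => by rw [h i (hj.trans hi)]
  have h1 := key u
  have h2 := key t
  rw [ht] at h1
  omega

theorem revLexLE_of_signLT {u t : Tab n l} (h : SignLT u.signs t.signs) : u.RevLexLE t := by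
  obtain ⟨i, h1, h2, h3⟩ := h
  have ne : (1 : ℤˣ) ≠ -1 := by decide
  have c1 : ∀ j : ℕ, i < j → count u.signs 1 j = count t.signs 1 j := fun j hj =>
    count_eq_of_tail (m := i + 1) (fun i' hi' => h3 i' hi')
      ((count_signs_one u).trans (count_signs_one t).symm) hj
  have c2 : ∀ j : ℕ, i < j → count u.signs (-1) j = count t.signs (-1) j := fun j hj =>
    count_eq_of_tail (m := i + 1) (fun i' hi' => h3 i' hi')
      ((count_signs_neg_one u).trans (count_signs_neg_one t).symm) hj
  have a1 := count_succ u.signs 1 i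
  have a2 := count_succ u.signs (-1) i
  have b1 := count_succ t.signs 1 i
  have b2 := count_succ t.signs (-1) i
  rw [c1 _ (Nat.lt_add_one (i : ℕ))] at a1
  rw [c2 _ (Nat.lt_add_one (i : ℕ))] at a2
  simp only [h1, h2, ne, ne.symm, if_true, if_false] at a1 a2 b1 b2
  refine .inr ⟨i, fun he => ?_, fun j hj => ?_, fun r => ?_⟩
  · have := congrArg (fun μ => YoungDiagram.rowLen μ 0) he
    simp only [rowLen_sub_zero] at this
    omega
  · ext ⟨r, c⟩
    rw [YoungDiagram.mem_cells, YoungDiagram.mem_cells, YoungDiagram.mem_iff_lt_rowLen,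
      YoungDiagram.mem_iff_lt_rowLen]
    rcases r with _ | _ | r
    · rw [rowLen_sub_zero, rowLen_sub_zero, c1 j hj]
    · rw [zero_add, rowLen_sub_one, rowLen_sub_one, c2 j hj]
    · rw [rowLen_sub_add_two, rowLen_sub_add_two]
  · rcases r with _ | _ | r
    · simp
    · simp only [zero_add, Finset.sum_range_one, rowLen_sub_zero]
      omega
    · have : ∀ v : Tab n l, ∑ r ∈ Finset.range (r + 1 + 1), (v.sub i).rowLen r =
          count v.signs 1 i + count v.signs (-1) i := by
        intro v
        rw [Finset.sum_range_succ', Finset.sum_range_succ', zero_add, rowLen_sub_one,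
          rowLen_sub_zero, Finset.sum_eq_zero fun r _ => rowLen_sub_add_two v i r, zero_add,
          add_comm]
      rw [this, this]
      omega

end Order

/-! ### Unitriangularity of half diagrams -/

section Triangular

variable {k : Type*} [CommRing k] {n l a b : ℕ} {G : (n : ℕ) → Hom k n n}

/-- Applying a linear map to a congruence modulo a span and a submodule. -/
theorem map_mem_span_sup {V W : Type*} [AddCommGroup V] [Module k V] [AddCommGroup W] [Module k W]
    (T : V →ₗ[k] W) {S : Set V} {N : Submodule k V} {P : Submodule k W}
    (hS : ∀ x ∈ S, T x ∈ P) (hN : ∀ x ∈ N, T x ∈ P) {x : V} (hx : x ∈ Submodule.span k S ⊔ N) :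
    T x ∈ P := by
  have h : Submodule.span k S ⊔ N ≤ P.comap T := sup_le (Submodule.span_le.2 hS) hN
  exact h hx

/-- Unitriangularity of the down morphisms, modulo lower through degree. -/
theorem downSeq_sub_mem (δ : k) (hG : ∀ n, G n - idHom k n ∈ tdLT k n) {s : Fin n → ℤˣ}
    (hs : IsBallot s l) :
    downSeq δ G s l - downSeq δ (idHom k) s l ∈
      Submodule.span k ((fun u => downSeq δ (idHom k) u l) ''
        {u : Fin n → ℤˣ | IsBallot u l ∧ SignLT u s}) ⊔ tdLT k l := by
  induction n generalizing l with
  | zero =>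
    cases hs
    simp [downSeq]
  | succ n ih =>
    -- extending a smaller sequence by the last sign of `s`
    have ext : ∀ (u : Fin n → ℤˣ), SignLT u (fun i : Fin n => s i.castSucc) →
        SignLT (Fin.snoc u (s (Fin.last n)) : Fin (n + 1) → ℤˣ) s := fun u hu =>
      .of_init (by simpa only [Fin.snoc_castSucc] using hu) (Fin.snoc_last _ _)
    rcases hs with ⟨h, l, rfl, hs⟩ | ⟨h, hs⟩
    · rw [downSeq_succ_pos δ _ h, downSeq_succ_pos δ _ h]
      have hAB := ih hs
      set A := downSeq δ G (fun i : Fin n => s i.castSucc) l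
      set B := downSeq δ (idHom k) (fun i : Fin n => s i.castSucc) l
      have e : epsPlus δ G A - epsPlus δ (idHom k) B =
          comp δ (G (l + 1) - idHom k (l + 1)) (tensorHom A (idHom k 1)) +
            tensorHom.flip (idHom k 1) (A - B) := by
        rw [epsPlus, epsPlus, id_comp, map_sub, LinearMap.sub_apply, id_comp, map_sub,
          LinearMap.flip_apply, LinearMap.flip_apply]
        abel
      rw [e]
      refine add_mem (Submodule.mem_sup_right (comp_mem_tdLT_left δ _ (hG _)))
        (map_mem_span_sup _ ?_ ?_ hAB)
      · rintro _ ⟨u, ⟨hu, hlt⟩, rfl⟩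
        refine Submodule.mem_sup_left (Submodule.subset_span
          ⟨(Fin.snoc u 1 : Fin (n + 1) → ℤˣ), ⟨.inl ⟨Fin.snoc_last _ _, l, rfl, ?_⟩, ?_⟩, ?_⟩)
        · simpa only [Fin.snoc_castSucc] using hu
        · rw [← h]; exact ext u hlt
        · simp only
          rw [downSeq_succ_pos δ _ (Fin.snoc_last _ _), epsPlus, id_comp]
          simp only [Fin.snoc_castSucc, LinearMap.flip_apply]
      · intro x hx
        refine Submodule.mem_sup_right (tdLT_induction (fun D hD => ?_) hx)
        rw [LinearMap.flip_apply, tensorHom_id]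
        rw [throughDegree_lt_iff] at hD
        exact ofDiagram_mem_tdLT ((throughDegree_lt_iff _).2 (addLine_full.not.2 hD))
    · rw [downSeq_succ_neg δ _ h, downSeq_succ_neg δ _ h]
      have hAB := ih hs
      set A := downSeq δ G (fun i : Fin n => s i.castSucc) (l + 1)
      set B := downSeq δ (idHom k) (fun i : Fin n => s i.castSucc) (l + 1)
      let cp : Hom k (l + 1 + 1) l := tensorHom (idHom k l) (ofDiagram Diagram.cap)
      let T : Hom k n (l + 1) →ₗ[k] Hom k (n + 1) l :=
        comp δ cp ∘ₗ tensorHom.flip (idHom k 1)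
      have e : epsMinus δ G A - epsMinus δ (idHom k) B =
          comp δ (G l - idHom k l) (T A) + T (A - B) := by
        rw [map_sub T, map_sub (comp δ), LinearMap.sub_apply, id_comp, epsMinus, epsMinus, id_comp]
        simp only [T, LinearMap.comp_apply, LinearMap.flip_apply, cp]
        abel
      rw [e]
      refine add_mem (Submodule.mem_sup_right (comp_mem_tdLT_left δ _ (hG _)))
        (map_mem_span_sup _ ?_ ?_ hAB)
      · rintro _ ⟨u, ⟨hu, hlt⟩, rfl⟩
        refine Submodule.mem_sup_left (Submodule.subset_span
          ⟨(Fin.snoc u (-1) : Fin (n + 1) → ℤˣ), ⟨.inr ⟨Fin.snoc_last _ _, ?_⟩, ?_⟩, ?_⟩)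
        · simpa only [Fin.snoc_castSucc] using hu
        · rw [← h]; exact ext u hlt
        · simp only
          rw [downSeq_succ_neg δ _ (Fin.snoc_last _ _), epsMinus, id_comp]
          simp only [Fin.snoc_castSucc]
          rfl
      · intro x hx
        refine tdLT_induction (fun D hD => ?_) hx
        have hT : T (ofDiagram D) = ofDiagram (bendDown D) := comp_capRight δ D
        rw [hT]
        rw [throughDegree_lt_iff] at hD
        by_cases hf : Full (bendDown D)
        · -- the cap has straightened a cup: the last sign of `s` has been changed to `+1`
          obtain ⟨h1, h2⟩ := hf.isBallot_and_downSeq δ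
          exact Submodule.mem_sup_left (Submodule.subset_span
            ⟨_, ⟨h1, .of_last (sgn_bendDown_last_of_not_full hD hf) h⟩, h2⟩)
        · exact Submodule.mem_sup_right (ofDiagram_mem_tdLT ((throughDegree_lt_iff _).2 hf))

theorem down_sub_mem (δ : k) (hG : ∀ n, G n - idHom k n ∈ tdLT k n) (t : Tab n l) :
    down δ G t - down δ (idHom k) t ∈
      Submodule.span k (down δ (idHom k) '' {u : Tab n l | SignLT u.signs t.signs}) ⊔
        tdLT k l := by
  have h := downSeq_sub_mem δ hG (isBallot_signs t)
  refine sup_le_sup_right (α := Submodule k (Hom k n l)) (Submodule.span_mono ?_) _ h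
  rintro _ ⟨u, ⟨hu, hlt⟩, rfl⟩
  obtain ⟨u, rfl⟩ := exists_signs_eq hu
  exact ⟨u, hlt, rfl⟩

theorem up_sub_mem (δ : k) (hG : ∀ n, G n - idHom k n ∈ tdLT k n) (t : Tab n l) :
    up δ G t - up δ (idHom k) t ∈
      Submodule.span k (up δ (idHom k) '' {u : Tab n l | SignLT u.signs t.signs}) ⊔
        tdLT k l := by
  rw [up, up, ← map_sub]
  refine map_mem_span_sup _ ?_ ?_ (down_sub_mem δ hG t)
  · rintro _ ⟨u, hu, rfl⟩
    exact Submodule.mem_sup_left (Submodule.subset_span ⟨u, hu, rfl⟩)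
  · exact fun x hx => Submodule.mem_sup_right (flipHom_mem_tdLT hx)

/-- The strict product order on pairs of tableaux, for the reverse lexicographic order. -/
def PairLT (u : Tab b l) (v : Tab a l) (s : Tab b l) (t : Tab a l) : Prop :=
  (u = s ∨ SignLT u.signs s.signs) ∧ (v = t ∨ SignLT v.signs t.signs) ∧ (u, v) ≠ (s, t)

theorem comp_mem_span (δ : k) {p q r : ℕ} {S : Set (Hom k q r)} {S' : Set (Hom k p q)}
    {f : Hom k q r} {g : Hom k p q} (hf : f ∈ Submodule.span k S)
    (hg : g ∈ Submodule.span k S') :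
    comp δ f g ∈ Submodule.span k (Set.image2 (fun f g => comp δ f g) S S') := by
  have := Submodule.apply_mem_map₂ (comp δ) hf hg
  rwa [Submodule.map₂_span_span] at this

theorem ladder_sub_mem (δ : k) (hG : ∀ n, G n - idHom k n ∈ tdLT k n) (s : Tab b l)
    (t : Tab a l) :
    ladder δ G s t - ladder δ (idHom k) s t ∈
      Submodule.span k {x | ∃ u v, PairLT u v s t ∧ x = ladder δ (idHom k) u v} ⊔
        tdLT k l := by
  obtain ⟨p, hp, x, hx, h1⟩ := Submodule.mem_sup.1 (up_sub_mem δ hG s)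
  obtain ⟨q, hq, y, hy, h2⟩ := Submodule.mem_sup.1 (down_sub_mem δ hG t)
  have e1 : up δ G s = up δ (idHom k) s + p + x := by rw [add_assoc, h1]; abel
  have e2 : down δ G t = down δ (idHom k) t + q + y := by rw [add_assoc, h2]; abel
  have e : ladder δ G s t - ladder δ (idHom k) s t =
      (comp δ p (down δ (idHom k) t + q) + comp δ (up δ (idHom k) s) q) +
        (comp δ x (down δ G t) + comp δ (up δ (idHom k) s + p) y) := by
    rw [ladder, ladder, e1]
    simp only [map_add, LinearMap.add_apply, e2]
    abel
  rw [e]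
  refine add_mem (Submodule.mem_sup_left ?_) (Submodule.mem_sup_right
    (add_mem (comp_mem_tdLT_left δ _ hx) (comp_mem_tdLT_right δ _ hy)))
  have hq' : down δ (idHom k) t + q ∈ Submodule.span k
      (down δ (idHom k) '' {v : Tab a l | v = t ∨ SignLT v.signs t.signs}) :=
    add_mem (Submodule.subset_span ⟨t, .inl rfl, rfl⟩)
      (Submodule.span_mono (Set.image_mono fun _ => .inr) hq)
  refine add_mem (Submodule.span_mono ?_ (comp_mem_span δ hp hq'))
    (Submodule.span_mono ?_ (comp_mem_span δ
      (Submodule.subset_span (Set.mem_singleton (up δ (idHom k) s))) hq))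
  · rintro _ ⟨_, ⟨u, hu, rfl⟩, _, ⟨v, hv, rfl⟩, rfl⟩
    refine ⟨u, v, ⟨.inr hu, hv, fun h => hu.ne ?_⟩, rfl⟩
    exact congrArg StdTableau.signs (congrArg Prod.fst h)
  · rintro _ ⟨_, rfl, _, ⟨v, hv, rfl⟩, rfl⟩
    refine ⟨s, v, ⟨.inl rfl, .inr hv, fun h => hv.ne ?_⟩, rfl⟩
    exact congrArg StdTableau.signs (congrArg Prod.snd h)

theorem PairLT.binary_lt {u s : Tab b l} {v t : Tab a l} (h : PairLT u v s t) :
    binary u.signs + binary v.signs < binary s.signs + binary t.signs := by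
  obtain ⟨rfl | h1, rfl | h2, h3⟩ := h
  · exact absurd rfl h3
  · have := h2.binary_lt; omega
  · have := h1.binary_lt; omega
  · have := h1.binary_lt; have := h2.binary_lt; omega

end Triangular

/-! ### The diagram basis -/

section DiagramBasis

variable {k : Type*} [CommRing k] {n l a b : ℕ}

/-- The half diagram of a tableau. -/
noncomputable def half (t : Tab n l) : Diagram n l := (isBallot_signs t).exists_full.choose

theorem half_full (t : Tab n l) : Full (half t) := (isBallot_signs t).exists_full.choose_spec.1

theorem sgn_half (t : Tab n l) : sgn (half t) = t.signs :=
  (isBallot_signs t).exists_full.choose_spec.2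

theorem Full.exists_half {D : Diagram n l} (hD : Full D) : ∃ t : Tab n l, half t = D := by
  obtain ⟨t, ht⟩ := exists_signs_eq (hD.isBallot_and_downSeq (0 : ℤ)).1
  exact ⟨t, (half_full t).eq_of_sgn_eq hD ((sgn_half t).trans ht)⟩

theorem down_id (δ : k) (t : Tab n l) : down δ (idHom k) t = ofDiagram (half t) := by
  rw [down, ← sgn_half, ((half_full t).isBallot_and_downSeq δ).2]

theorem up_id (δ : k) (t : Tab n l) : up δ (idHom k) t = ofDiagram (half t).flip := by
  rw [up, down_id, flipHom_ofDiagram]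

/-- The diagram with a given pair of half diagrams. -/
noncomputable def glue (x : (l : ℕ) × (Tab b l × Tab a l)) : Diagram a b :=
  (exists_isConcat (half x.2.1).flip (half x.2.2)).choose

theorem isConcat_glue (x : (l : ℕ) × (Tab b l × Tab a l)) :
    Diagram.IsConcat (half x.2.1).flip (half x.2.2) (glue x) :=
  (exists_isConcat (half x.2.1).flip (half x.2.2)).choose_spec

theorem ladder_id (δ : k) (x : (l : ℕ) × (Tab b l × Tab a l)) :
    ladder δ (idHom k) x.2.1 x.2.2 = ofDiagram (glue x) := by
  rw [ladder, up_id, down_id, comp_ofDiagram, compDiagram_eq δ (isConcat_glue x),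
    loops_of_full (half_full _), pow_zero, one_smul]

theorem throughDegree_glue (x : (l : ℕ) × (Tab b l × Tab a l)) :
    (glue x).throughDegree = x.1 :=
  throughDegree_of_isConcat (half_full _) (half_full _) (isConcat_glue x)

theorem glue_injective :
    Function.Injective (glue : (l : ℕ) × (Tab b l × Tab a l) → Diagram a b) := by
  rintro ⟨l, s, t⟩ ⟨l', s', t'⟩ h
  have hl : l = l' := by
    have := congrArg Diagram.throughDegree h
    rwa [throughDegree_glue, throughDegree_glue] at this
  subst hl
  have key : ∀ (s : Tab b l) (t : Tab a l), sgn (glue ⟨l, s, t⟩) = t.signs ∧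
      sgn (glue ⟨l, s, t⟩).flip = s.signs := by
    intro s t
    have h1 := isConcat_glue ⟨l, s, t⟩
    have h2 := isConcat_flip h1
    rw [flip_flip] at h2
    exact ⟨(sgn_of_isConcat (half_full s) h1).trans (sgn_half t),
      (sgn_of_isConcat (half_full t) h2).trans (sgn_half s)⟩
  have ht : t = t' := signs_injective (by rw [← (key s t).1, h, (key s' t').1])
  have hs : s = s' := signs_injective (by rw [← (key s t).2, h, (key s' t').2])
  rw [hs, ht]

theorem glue_surjective :
    Function.Surjective (glue : (l : ℕ) × (Tab b l × Tab a l) → Diagram a b) := by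
  intro D
  obtain ⟨l, E, F, hE, hF, h⟩ := exists_factorization D
  obtain ⟨t, rfl⟩ := hE.exists_half
  obtain ⟨s, rfl⟩ := hF.exists_half
  exact ⟨⟨l, s, t⟩, isConcat_unique (isConcat_glue ⟨l, s, t⟩)
    (isConcat_of_mat (a := 0) (h.trans (one_smul ℕ _).symm)).1⟩

end DiagramBasis

/-! ### Light ladder bases -/

section Ladder

variable {k : Type*} [CommRing k] {n l a b : ℕ} {G : (n : ℕ) → Hom k n n}

/-- The light ladders span, compatibly with the filtration by the through degree. -/
theorem tdLT_le_span_ladder (δ : k) (hG : ∀ n, G n - idHom k n ∈ tdLT k n) (l : ℕ) :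
    (tdLT k l : Submodule k (Hom k a b)) ≤ Submodule.span k
      {x | ∃ v < l, ∃ (s : Tab b v) (t : Tab a v), x = ladder δ G s t} := by
  induction l with
  | zero =>
    rw [tdLT_eq_span, Submodule.span_le]
    rintro _ ⟨D, hD, rfl⟩
    exact absurd hD (Nat.not_lt_zero _)
  | succ l ih =>
    have ih' := ih.trans (Submodule.span_mono (t :=
      {x | ∃ v < l + 1, ∃ (s : Tab b v) (t : Tab a v), x = ladder δ G s t})
      fun x ⟨v, hv, h⟩ => ⟨v, by omega, h⟩)
    rw [tdLT_eq_span, Submodule.span_le]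
    rintro _ ⟨D, hD, rfl⟩
    obtain ⟨x, rfl⟩ := glue_surjective D
    obtain ⟨v, s, t⟩ := x
    rw [Set.mem_ofPred_eq, throughDegree_glue] at hD
    rcases Nat.lt_succ_iff_lt_or_eq.1 hD with hv | rfl
    · exact ih' (ofDiagram_mem_tdLT (by rwa [throughDegree_glue]))
    · rw [← ladder_id δ]
      -- induction along the reverse lexicographic order
      induction hN : binary s.signs + binary t.signs using Nat.strong_induction_on
        generalizing s t with
      | _ N IH =>
      have h := ladder_sub_mem δ hG s t
      have hle : Submodule.span k {x | ∃ u v, PairLT u v s t ∧ x = ladder δ (idHom k) u v} ⊔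
          tdLT k v ≤ Submodule.span k
            {x | ∃ v' < v + 1, ∃ (s : Tab b v') (t : Tab a v'), x = ladder δ G s t} := by
        refine sup_le (Submodule.span_le.2 ?_) ih'
        rintro _ ⟨u, w, hlt, rfl⟩
        exact IH _ (hN ▸ hlt.binary_lt) u w ih ih' hD rfl
      have h' : ladder δ G s t ∈ Submodule.span k
          {x | ∃ v' < v + 1, ∃ (s : Tab b v') (t : Tab a v'), x = ladder δ G s t} :=
        Submodule.subset_span ⟨v, Nat.lt_succ_self v, s, t, rfl⟩
      have := sub_mem h' (hle h)
      rwa [sub_sub_cancel] at this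

theorem span_ladder (δ : k) (hG : ∀ n, G n - idHom k n ∈ tdLT k n) (a b : ℕ) :
    Submodule.span k (Set.range fun x : (l : ℕ) × (Tab b l × Tab a l) =>
      ladder δ G x.2.1 x.2.2) = ⊤ := by
  refine eq_top_iff.2 fun f _ => ?_
  induction f using hom_induction with
  | h0 => exact zero_mem _
  | hadd f g hf hg => exact add_mem (hf trivial) (hg trivial)
  | hs c D =>
    refine Submodule.smul_mem _ _ (Submodule.span_mono ?_ (tdLT_le_span_ladder δ hG _
      (ofDiagram_mem_tdLT (Nat.lt_succ_self D.throughDegree))))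
    rintro _ ⟨v, -, s, t, rfl⟩
    exact ⟨⟨v, s, t⟩, rfl⟩

/-- The light ladders span and are as many as the diagrams, so that they are a basis: a surjective
endomorphism of a finite module is injective. -/
theorem linearIndependent_ladder (δ : k) (hG : ∀ n, G n - idHom k n ∈ tdLT k n) (a b : ℕ) :
    LinearIndependent k (fun x : (l : ℕ) × (Tab b l × Tab a l) => ladder δ G x.2.1 x.2.2) := by
  let e := Equiv.ofBijective _ (⟨glue_injective, glue_surjective⟩ :
    Function.Bijective (glue : (l : ℕ) × (Tab b l × Tab a l) → Diagram a b))
  let B : Module.Basis ((l : ℕ) × (Tab b l × Tab a l)) k (Hom k a b) :=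
    Finsupp.basisSingleOne.reindex e.symm
  let T : Hom k a b →ₗ[k] Hom k a b :=
    B.constr k fun x : (l : ℕ) × (Tab b l × Tab a l) => ladder δ G x.2.1 x.2.2
  have hT : Function.Surjective T := by
    rw [← LinearMap.range_eq_top]
    exact (B.constr_range k).trans (span_ladder δ hG a b)
  have hT' := OrzechProperty.injective_of_surjective_endomorphism T hT
  have h := B.linearIndependent.map' T (LinearMap.ker_eq_bot.2 hT')
  have e' : T ∘ B = fun x : (l : ℕ) × (Tab b l × Tab a l) => ladder δ G x.2.1 x.2.2 :=
    funext fun x => B.constr_basis k (fun x => ladder δ G x.2.1 x.2.2) x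
  rwa [e'] at h

theorem mem_span_up_sup (δ : k) (hG : ∀ n, G n - idHom k n ∈ tdLT k n) (f : Hom k l n) :
    f ∈ Submodule.span k (Set.range (up δ G : Tab n l → Hom k l n)) ⊔ tdLT k l := by
  induction f using hom_induction with
  | h0 => exact zero_mem _
  | hadd f g hf hg => exact add_mem hf hg
  | hs c D =>
    refine Submodule.smul_mem _ _ ?_
    by_cases hD : D.throughDegree < l
    · exact Submodule.mem_sup_right (ofDiagram_mem_tdLT hD)
    · rw [← throughDegree_flip, throughDegree_lt_iff, not_not] at hD
      obtain ⟨t, ht⟩ := hD.exists_half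
      rw [← flip_flip D, ← ht, ← up_id δ]
      clear ht
      induction hN : binary t.signs using Nat.strong_induction_on generalizing t with
      | _ N IH =>
      have hle : Submodule.span k (up δ (idHom k) '' {u : Tab n l | SignLT u.signs t.signs}) ⊔
          tdLT k l ≤ Submodule.span k (Set.range (up δ G : Tab n l → Hom k l n)) ⊔ tdLT k l := by
        refine sup_le (Submodule.span_le.2 ?_) le_sup_right
        rintro _ ⟨u, hu, rfl⟩
        exact IH _ (hN ▸ hu.binary_lt) u rfl
      have h' : up δ G t ∈
          Submodule.span k (Set.range (up δ G : Tab n l → Hom k l n)) ⊔ tdLT k l :=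
        Submodule.mem_sup_left (Submodule.subset_span ⟨t, rfl⟩)
      have := sub_mem h' (hle (up_sub_mem δ hG t))
      rwa [sub_sub_cancel] at this

theorem exists_up_coeff (δ : k) (hG : ∀ n, G n - idHom k n ∈ tdLT k n) (f : Hom k l n) :
    ∃ r : Tab n l → k, f - ∑ u, r u • up δ G u ∈ tdLT k l := by
  obtain ⟨y, hy, z, hz, h⟩ := Submodule.mem_sup.1 (mem_span_up_sup δ hG f)
  obtain ⟨r, rfl⟩ := (Submodule.mem_span_range_iff_exists_fun k).1 hy
  refine ⟨r, ?_⟩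
  rw [← h, add_sub_cancel_left]
  exact hz

theorem exists_weight (t : Tab n l) : ∃ l₁ l₂ : ℕ, l₂ ≤ l₁ ∧ l₁ + l₂ = n ∧ l = l₁ - l₂ := by
  have h1 := (isBallot_iff.1 (isBallot_signs t)).2
  exact ⟨_, _, by omega, count_add_count t.signs le_rfl, by omega⟩

theorem flipHom_ladder (δ : k) (s : Tab b l) (t : Tab a l) :
    flipHom (ladder δ G s t) = ladder δ G t s := by
  rw [ladder, flipHom_comp, up, flipHom_flipHom, ladder, up]

theorem isCellular_ladder [Nontrivial k] (δ : k) (hG : ∀ n, G n - idHom k n ∈ tdLT k n) (n : ℕ) :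
    IsCellular k (comp δ : Hom k n n →ₗ[k] Hom k n n →ₗ[k] Hom k n n) (idHom k n)
      (fun w : Weight n => Tab n w.1) (fun _ s t => ladder δ G s t) flipHom := by
  have hli : LinearIndependent k (fun x : (w : Weight n) × (Tab n w.1 × Tab n w.1) =>
      ladder δ G x.2.1 x.2.2) :=
    (linearIndependent_ladder δ hG n n).comp
      (Sigma.map Subtype.val fun w => (id : Tab n w.1 × Tab n w.1 → _))
      (Subtype.val_injective.sigma_map fun _ => Function.injective_id)
  refine ⟨comp_assoc δ, id_comp δ, comp_id δ, hli.injective, hli, ?_, flipHom_flipHom,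
    flipHom_comp δ, fun w s t => flipHom_ladder δ s t, fun w f => ?_⟩
  · rw [← span_ladder δ hG n n]
    congr 1
    ext x
    constructor
    · rintro ⟨⟨w, s, t⟩, rfl⟩
      exact ⟨⟨w.1, s, t⟩, rfl⟩
    · rintro ⟨⟨l, s, t⟩, rfl⟩
      exact ⟨⟨⟨l, exists_weight s⟩, s, t⟩, rfl⟩
  · choose r hr using fun s : Tab n w.1 => exists_up_coeff δ hG (comp δ f (up δ G s))
    refine ⟨fun u s => r s u, fun s t => ?_⟩
    have e : comp δ f (ladder δ G s t) - ∑ u, r s u • ladder δ G u t =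
        comp δ (comp δ f (up δ G s) - ∑ u, r s u • up δ G u) (down δ G t) := by
      simp only [map_sub, map_sum, map_smul, LinearMap.sub_apply, LinearMap.sum_apply,
        LinearMap.smul_apply, comp_assoc, ladder]
    rw [e]
    refine Submodule.span_mono ?_ (tdLT_le_span_ladder δ hG w.1 (comp_mem_tdLT_left δ _ (hr s)))
    rintro _ ⟨v, hv, p, q, rfl⟩
    exact ⟨⟨v, exists_weight p⟩, hv, p, q, rfl⟩

end Ladder

end TL

theorem mainTheorem8 {k : Type*} [CommRing k] [Nontrivial k] (δ : k)
    (G : (n : ℕ) → TL.Hom k n n)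
    (hG : ∀ n : ℕ, G n - TL.idHom k n ∈ TL.tdLT k n) :
    -- bases of all morphism spaces
    (∀ a b : ℕ,
      LinearIndependent k (fun x : (l : ℕ) × (TL.Tab b l × TL.Tab a l) =>
        TL.ladder δ G x.2.1 x.2.2) ∧
      Submodule.span k (Set.range fun x : (l : ℕ) × (TL.Tab b l × TL.Tab a l) =>
        TL.ladder δ G x.2.1 x.2.2) = ⊤) ∧
    -- a cellular basis of the Temperley--Lieb algebra
    (∀ n : ℕ, IsCellular k (TL.comp δ : TL.Hom k n n →ₗ[k] TL.Hom k n n →ₗ[k] TL.Hom k n n)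
      (TL.idHom k n) (fun w : TL.Weight n => TL.Tab n w.1)
      (fun _ s t => TL.ladder δ G s t) TL.flipHom) ∧
    -- the identity family gives the diagram basis
    (∀ a b : ℕ, Set.range (fun x : (l : ℕ) × (TL.Tab b l × TL.Tab a l) =>
        TL.ladder δ (TL.idHom k) x.2.1 x.2.2) =
      Set.range (TL.ofDiagram : TL.Diagram a b → TL.Hom k a b)) ∧
    -- unitriangularity on half diagrams, i.e. in every cell module
    (∀ (n l : ℕ) (t : TL.Tab n l),
      TL.up δ G t - TL.up δ (TL.idHom k) t ∈
        Submodule.span k (TL.up δ (TL.idHom k) '' {u : TL.Tab n l | u.RevLexLT t}) ⊔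
          TL.tdLT k l) ∧
    -- unitriangularity on all morphism spaces
    (∀ (a b l : ℕ) (s : TL.Tab b l) (t : TL.Tab a l),
      TL.ladder δ G s t - TL.ladder δ (TL.idHom k) s t ∈
        Submodule.span k {x : TL.Hom k a b | ∃ (u : TL.Tab b l) (v : TL.Tab a l),
          u.RevLexLE s ∧ v.RevLexLE t ∧ (u, v) ≠ (s, t) ∧
          x = TL.ladder δ (TL.idHom k) u v} ⊔
          TL.tdLT k l) := by
  refine ⟨fun a b => ⟨TL.linearIndependent_ladder δ hG a b, TL.span_ladder δ hG a b⟩,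
    TL.isCellular_ladder δ hG, fun a b => ?_, fun n l t => ?_, fun a b l s t => ?_⟩
  · rw [← TL.glue_surjective.range_comp TL.ofDiagram]
    exact congrArg Set.range (funext fun x => TL.ladder_id δ x)
  · refine sup_le_sup_right (α := Submodule k (TL.Hom k l n)) (Submodule.span_mono ?_) _
      (TL.up_sub_mem δ hG t)
    rintro _ ⟨u, hu, rfl⟩
    exact ⟨u, ⟨TL.revLexLE_of_signLT hu, fun h => hu.ne (congrArg _ h)⟩, rfl⟩
  · refine sup_le_sup_right (α := Submodule k (TL.Hom k a b)) (Submodule.span_mono ?_) _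
      (TL.ladder_sub_mem δ hG s t)
    rintro _ ⟨u, v, ⟨hu, hv, hne⟩, rfl⟩
    exact ⟨u, v, hu.elim Or.inl TL.revLexLE_of_signLT,
      hv.elim Or.inl TL.revLexLE_of_signLT, hne, rfl⟩
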